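/- Consider a stochastic bandit with $N\ge 1$ arms and horizon $T$. Arm $a$ has a reward law with mean $\mu_a$ that is $1$-subGaussian, i.e. $\mathbb{E}\,e^{\lambda(r-\mu_a)}\le e^{\lambda^2/2}$ for all $\lambda\in\mathbb{R}$; rewards of all pulls are independent. Let $\Delta_a=\max_b\mu_b-\mu_a$. Fix constants $\rho\in(1/2,1)$ and $\alpha\ge 4$, and let $\log^+x=\max\{0,\log x\}$. The algorithm B-MOTS keeps, for each arm $a$, its number of pulls $k_a$, a level $\ell_a$ (initially $0$) and the number $n_a\le k_a$ of its rewards on which its current estimate is based. It first plays each arm once. In every later round $t$ it draws, independently for each arm and independently of everything else, $\tilde\theta_a(t)\sim\mathcal N\big(\hat\mu_{a,n_a},\tfrac{1}{\rho n_a}\big)$, where $\hat\mu_{a,s}$ is the average of the first $s$ rewards of arm $a$, clips it to $$\theta_a(t)=\min\Big\{\tilde\theta_a(t),\ \hat\mu_{a,n_a}+\sqrt{\tfrac{\alpha}{n_a}\log^+\tfrac{T}{N n_a}}\Big\},$$ and plays an arm $a(t)\in\arg\max_a\theta_a(t)$ (ties are broken by any fixed measurable rule). In every round, the initial ones included, the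 count of the played arm $a=a(t)$ is increased by one; if then $k_{a}=2^{\ell_{a}}$, the algorithm increases $\ell_{a}$ by one and queries the batch of pending pulls, after which the estimates are refreshed. Two refresh rules are allowed: either all pending rewards are used ($n_b:=k_b$ for all arms $b$), or only the estimate of the arm that triggered the query is refreshed ($n_a:=k_a$), so that $n_b$ is always the largest power of two not exceeding $k_b$. Then there is a constant $C$ depending only on $\rho$ and $\alpha$ such that, for either refresh rule and for all $N$, $T$ and all reward laws as above, the expected regret $\mathcal R(T)=\mathbb{E}\big[\sum_{t=1}^T\Delta_{a(t)}\big]$ satisfies $$\mathcal R(T)\le C\Big(\sqrt{NT}+\sum_{a=1}^N\Delta_a\Big);$$ in particular $\mathcal R(T)\le C\sqrt{NT}$ whenever $\Delta_a\le 1$ for all $a$. Moreover, the number of batch queries in $T$ rounds is always at most $N(\lfloor\log_2T\rfloor+1)=O(N\log T)$. -/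

import Mathlib

open MeasureTheory ProbabilityTheory

noncomputable section

namespace BMOTS

/-- Which estimates are refreshed when a batch is queried: those of all arms (every pending reward
is used), or only that of the arm whose pull count has just reached a power of two (so that the
estimate of an arm is always based on the largest power of two not exceeding its pull count). -/
inductive Refresh
  | all
  | trigger

/-- Average of the first `s` rewards of an arm. -/
def empMean (x : ℕ → ℝ) (s : ℕ) : ℝ := (∑ i ∈ Finset.range s, x i) / s

/-- The clipping level `μ̂ₛ + √((α / s) log⁺ (T / (s N)))`. -/
def clipLevel (N T : ℕ) (α : ℝ) (x : ℕ → ℝ) (s : ℕ) : ℝ :=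
  empMean x s + √(α / s * Real.posLog ((T : ℝ) / (s * N)))

/-- The clipped Gaussian sample: if `z` is standard normal, the first argument of `min` has law
`𝒩(μ̂ₛ, 1 / (ρ s))`. -/
def clippedSample (N T : ℕ) (ρ α : ℝ) (x : ℕ → ℝ) (s : ℕ) (z : ℝ) : ℝ :=
  min (empMean x s + z / √(ρ * s)) (clipLevel N T α x s)

/-- Counters kept by the algorithm. -/
structure State (N : ℕ) where
  /-- number of pulls of each arm so far -/
  pulls : Fin N → ℕ
  /-- the next batch query caused by arm `a` is made when its pull count reaches `2 ^ level a` -/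
  level : Fin N → ℕ
  /-- number of rewards of each arm on which its current estimate is based -/
  seen : Fin N → ℕ
  /-- number of batch queries so far -/
  batches : ℕ

/-- Parameters of the algorithm: horizon `T`, the constants `ρ` and `α`, a selection `argmax` of a
coordinate that maximizes a vector, and the refresh rule. -/
structure Params (N : ℕ) where
  T : ℕ
  ρ : ℝ
  α : ℝ
  argmax : (Fin N → ℝ) → Fin N
  refresh : Refresh

variable {N : ℕ}

/-- The arm played in round `t` (rounds are numbered from `0`). Each arm is played once first; then
the arm with the largest sample is played. `x a i` is the reward of the `(i+1)`-st pull of arm `a`,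
and `z t a` is the standard normal number used for arm `a` in round `t`. -/
def nextArm (p : Params N) (x : Fin N → ℕ → ℝ) (z : ℕ → Fin N → ℝ) (t : ℕ) (σ : State N) : Fin N :=
  if h : t < N then ⟨t, h⟩
  else p.argmax fun a => clippedSample N p.T p.ρ p.α (x a) (σ.seen a) (z t a)

/-- Update of the counters when arm `a` is played. -/
def State.play (r : Refresh) (σ : State N) (a : Fin N) : State N :=
  let k : Fin N → ℕ := Function.update σ.pulls a (σ.pulls a + 1)
  if k a < 2 ^ σ.level a then
    { σ with pulls := k }
  else
    { pulls := k
      level := Function.update σ.level a (σ.level a + 1)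
      seen := match r with
        | .all => k
        | .trigger => Function.update σ.seen a (k a)
      batches := σ.batches + 1 }

/-- The state before round `t`, i.e. after `t` rounds. -/
def state (p : Params N) (x : Fin N → ℕ → ℝ) (z : ℕ → Fin N → ℝ) : ℕ → State N
  | 0 => { pulls := fun _ => 0, level := fun _ => 0, seen := fun _ => 0, batches := 0 }
  | t + 1 => (state p x z t).play p.refresh (nextArm p x z t (state p x z t))

/-- The arm played in round `t`. -/
def arm (p : Params N) (x : Fin N → ℕ → ℝ) (z : ℕ → Fin N → ℝ) (t : ℕ) : Fin N :=
  nextArm p x z t (state p x z t)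

/-- Mean of arm `a`. -/
def mean (ν : Fin N → Measure ℝ) (a : Fin N) : ℝ := ∫ y, y ∂(ν a)

/-- Gap of arm `a`. -/
def gap (ν : Fin N → Measure ℝ) (a : Fin N) : ℝ := (⨆ b, mean ν b) - mean ν a

/-- Regret accumulated over the `T` rounds: `∑ₜ (max_b μ_b - μ_{a(t)})`. -/
def regret (p : Params N) (ν : Fin N → Measure ℝ) (x : Fin N → ℕ → ℝ) (z : ℕ → Fin N → ℝ) : ℝ :=
  ∑ t ∈ Finset.range p.T, gap ν (arm p x z t)

/-- A stochastic bandit together with the internal randomness of the algorithm: arm `a` yields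
i.i.d. rewards with law `ν a`, the numbers `Z t a` are standard normal, and everything is
independent. The laws `ν a` are `1`-subGaussian about their means. -/
structure IsModel {Ω : Type*} [MeasurableSpace Ω] (P : Measure Ω) (ν : Fin N → Measure ℝ)
    (X : Fin N → ℕ → Ω → ℝ) (Z : ℕ → Fin N → Ω → ℝ) : Prop where
  subgaussian : ∀ a, HasSubgaussianMGF (fun y => y - mean ν a) 1 (ν a)
  measurable_reward : ∀ a i, Measurable (X a i)
  measurable_noise : ∀ t a, Measurable (Z t a)
  law_reward : ∀ a i, HasLaw (X a i) (ν a) P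
  law_noise : ∀ t a, HasLaw (Z t a) (gaussianReal 0 1) P
  indep : iIndepFun (Sum.elim (fun q : Fin N × ℕ => X q.1 q.2) (fun q : ℕ × Fin N => Z q.1 q.2)) P

end BMOTS

end

/-! Let `s` be a best arm, `d = √(N/T)`, and charge each round after the initial plays, which cost
at most the sum of the gaps, to one of three sources.

Arms with gap below `2d` cost at most `2dT = 2√(NT)`.

The clipping level of `s` may drop too low. By a maximal inequality on dyadic blocks of sample sizes
(`measure_exists_clip_le`), it falls `2^j d` below the mean with probability at most `24 · 4^(-j)`.
The gaps charged to that event are at most `2^(j+2) d`, so this costs a constant times `dT`.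

Otherwise an arm `a` with gap `2δ ≥ 2d` is played while the clipping level of `s` exceeds the
midpoint `y` of the two means. If the sample of `a` is at most `y`, all samples are. Conditionally
on the past they are independent, so this event is at most the odds that the sample of `s` stays
below `y`, times the probability of playing `s` (`pi_gaussian_argmax_le`,
`IsModel.lintegral_round_le`). Summing over rounds therefore counts plays of `s`. If the sample of
`a` exceeds `y`, so does its clipping level, which happens for few pull counts
(`sum_measure_exists_clip_gt_le`). Together these give `O((1 + log⁺(Tδ²/N))/δ²)` plays, and a regret
`O(√(T/N))` for each arm.

Batching enters only through `k/2 < n ≤ k`, where `k` is the pull count and `n` the number of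
rewards seen; both refresh rules ensure it. Each round is charged to its pull count, with a supremum
over all compatible `n`, so no knowledge of the refresh times is needed. The odds for `s` grow like
`exp(ρ S_n²/(2n))` when the centred sum `S_n` is very negative. Since `ρ < 1`, the supremum of such
exponentials over a block is integrable, provided the maximal inequality loses little:
`measure_exists_sq_partialSum_ge_le` cuts the block into many short pieces for this purpose. -/

open scoped ENNReal

universe u

namespace BMOTS

/-! ### Independence of σ-algebras generated by disjoint subfamilies. -/

section Independence

variable {Ω ι : Type*}

/-- The σ-algebra generated by the members of a family of real functions with index in `S`. -/
abbrev famSigma (f : ι → Ω → ℝ) (S : Set ι) : MeasurableSpace Ω :=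
  ⨆ i ∈ S, MeasurableSpace.comap (f i) inferInstance

lemma famSigma_le [MeasurableSpace Ω] {f : ι → Ω → ℝ} (hf : ∀ i, Measurable (f i)) (S : Set ι) :
    famSigma f S ≤ ‹MeasurableSpace Ω› :=
  iSup₂_le fun i _ => (hf i).comap_le

lemma measurable_famSigma (f : ι → Ω → ℝ) {S : Set ι} {i : ι} (hi : i ∈ S) :
    Measurable[famSigma f S] (f i) :=
  (comap_measurable (f i)).mono (le_iSup₂_of_le i hi le_rfl) le_rfl

lemma indep_famSigma [MeasurableSpace Ω] {P : Measure Ω} {f : ι → Ω → ℝ}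
    (hf : ∀ i, Measurable (f i)) (h : iIndepFun f P) {S S' : Set ι} (hS : Disjoint S S') :
    Indep (famSigma f S) (famSigma f S') P :=
  indep_iSup_of_disjoint (fun i => (hf i).comap_le) h.iIndep hS

end Independence

/-! ### Maximal inequalities for subgaussian partial sums. -/

section Maximal

variable {Ω : Type*} {Y : ℕ → Ω → ℝ}

/-- Partial sums of a sequence of random variables. -/
def partialSum (Y : ℕ → Ω → ℝ) (n : ℕ) (ω : Ω) : ℝ := ∑ i ∈ Finset.range n, Y i ω

lemma partialSum_succ (Y : ℕ → Ω → ℝ) (n : ℕ) (ω : Ω) :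
    partialSum Y (n + 1) ω = partialSum Y n ω + Y n ω := Finset.sum_range_succ _ _

lemma measurable_partialSum_famSigma (Y : ℕ → Ω → ℝ) {m n : ℕ} (h : m ≤ n) :
    Measurable[famSigma Y (Set.Iio n)] (partialSum Y m) :=
  @Finset.measurable_fun_sum _ _ _ _ _ _ (famSigma Y (Set.Iio n)) _ _ fun _ hi =>
    measurable_famSigma Y (lt_of_lt_of_le (Finset.mem_range.1 hi) h)

variable [MeasurableSpace Ω] {P : Measure Ω}

lemma measurable_partialSum (hY : ∀ i, Measurable (Y i)) (n : ℕ) : Measurable (partialSum Y n) :=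
  Finset.measurable_fun_sum _ fun i _ => hY i

lemma lintegral_exp_le_one {U : Ω → ℝ} (hU : HasSubgaussianMGF U 1 P) (l : ℝ) :
    ∫⁻ ω, ENNReal.ofReal (Real.exp (l * U ω - l ^ 2 / 2)) ∂P ≤ 1 := by
  have hi : Integrable (fun ω => Real.exp (l * U ω - l ^ 2 / 2)) P := by
    simp_rw [Real.exp_sub]
    exact (hU.integrable_exp_mul l).div_const _
  rw [← ofReal_integral_eq_lintegral_ofReal hi (ae_of_all _ fun _ => (Real.exp_pos _).le)]
  rw [← ENNReal.ofReal_one]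
  apply ENNReal.ofReal_le_ofReal
  simp_rw [Real.exp_sub, integral_div]
  rw [div_le_one (Real.exp_pos _)]
  simpa [mgf] using hU.mgf_le l

/-- The exponential supermartingale of a sum of independent subgaussian variables, stopped when the
sum reaches `x`. -/
lemma lintegral_stopped_exp_le_one [IsProbabilityMeasure P] (hY : ∀ i, Measurable (Y i))
    (hind : iIndepFun Y P) (hsub : ∀ i, HasSubgaussianMGF (Y i) 1 P) {x l : ℝ} (hx : 0 < x)
    (hl : 0 ≤ l) (b n : ℕ) (hn : n ≤ b) :
    ENNReal.ofReal (Real.exp (l * x - b * (l ^ 2 / 2))) * P {ω | ∃ m ≤ n, x ≤ partialSum Y m ω}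
      + ∫⁻ ω in {ω | ∃ m ≤ n, x ≤ partialSum Y m ω}ᶜ,
        ENNReal.ofReal (Real.exp (l * partialSum Y n ω - n * (l ^ 2 / 2))) ∂P ≤ 1 := by
  set A : ℕ → Set Ω := fun n => {ω | ∃ m ≤ n, x ≤ partialSum Y m ω} with hA
  set M : ℕ → Ω → ℝ≥0∞ := fun n ω =>
    ENNReal.ofReal (Real.exp (l * partialSum Y n ω - n * (l ^ 2 / 2))) with hM
  set c := ENNReal.ofReal (Real.exp (l * x - b * (l ^ 2 / 2))) with hc
  have hAF : ∀ n, MeasurableSet[famSigma Y (Set.Iio n)] (A n) := fun n => by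
    have : A n = ⋃ m ∈ Set.Iic n, {ω | x ≤ partialSum Y m ω} := by ext; simp [hA]
    rw [this]
    refine MeasurableSet.biUnion (Set.to_countable _) fun m hm => ?_
    exact measurable_partialSum_famSigma Y hm measurableSet_Ici
  have hAm : ∀ n, MeasurableSet (A n) := fun n => famSigma_le hY _ _ (hAF n)
  have hMm : ∀ n, Measurable (M n) := fun n => by
    have := measurable_partialSum hY n
    fun_prop
  change c * P (A n) + ∫⁻ ω in (A n)ᶜ, M n ω ∂P ≤ 1
  induction n with
  | zero =>
    have h0 : A 0 = ∅ := by
      ext ω; simp [hA, partialSum, hx]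
    simp [h0, hM, partialSum]
  | succ n ih =>
    have hsubset : A n ⊆ A (n + 1) := fun ω ⟨m, hm, h⟩ => ⟨m, hm.trans n.le_succ, h⟩
    have hstep : ∫⁻ ω in (A n)ᶜ, M (n + 1) ω ∂P ≤ ∫⁻ ω in (A n)ᶜ, M n ω ∂P := by
      rw [← lintegral_indicator (hAm n).compl, ← lintegral_indicator (hAm n).compl]
      have hfac : ∀ ω, (A n)ᶜ.indicator (M (n + 1)) ω = (A n)ᶜ.indicator (M n) ω *
          ENNReal.ofReal (Real.exp (l * Y n ω - l ^ 2 / 2)) := fun ω => by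
        by_cases h : ω ∈ (A n)ᶜ
        · simp only [Set.indicator_of_mem h, hM]
          rw [← ENNReal.ofReal_mul (Real.exp_pos _).le, ← Real.exp_add, partialSum_succ]
          congr 2; push_cast; ring
        · simp [Set.indicator_of_notMem h]
      simp_rw [hfac]
      -- The event of no crossing and the exponential up to time `n` depend only on the first `n`
      -- variables, so the new factor splits off with expectation at most one.
      rw [lintegral_mul_eq_lintegral_mul_lintegral_of_independent_measurableSpace
        (famSigma_le hY (Set.Iio n)) (famSigma_le hY {n}) (indep_famSigma hY hind (by simp))
        ?_ ?_]
      · exact mul_le_of_le_one_right' (lintegral_exp_le_one (hsub n) l)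
      · refine Measurable.indicator ?_ (hAF n).compl
        have := measurable_partialSum_famSigma Y (le_refl n)
        refine ENNReal.measurable_ofReal.comp (Real.measurable_exp.comp ?_)
        exact (this.const_mul l).sub_const _
      · have := measurable_famSigma Y (Set.mem_singleton n)
        refine ENNReal.measurable_ofReal.comp (Real.measurable_exp.comp ?_)
        exact (this.const_mul l).sub_const _
    have hsplit : P (A (n + 1)) = P (A n) + P (A (n + 1) \ A n) := by
      rw [← measure_inter_add_sdiff (A (n + 1)) (hAm n), Set.inter_eq_right.2 hsubset]
    have hint : ∫⁻ ω in (A n)ᶜ, M (n + 1) ω ∂P =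
        ∫⁻ ω in A (n + 1) \ A n, M (n + 1) ω ∂P + ∫⁻ ω in (A (n + 1))ᶜ, M (n + 1) ω ∂P := by
      rw [← lintegral_union (hAm _).compl]
      · congr 2
        ext ω
        have := @hsubset ω
        simp only [Set.mem_compl_iff, Set.mem_union, Set.mem_sdiff]
        tauto
      · exact Set.disjoint_left.2 fun ω h h' => h' h.1
    have hlow : c * P (A (n + 1) \ A n) ≤ ∫⁻ ω in A (n + 1) \ A n, M (n + 1) ω ∂P := by
      rw [← setLIntegral_const]
      refine setLIntegral_mono' ((hAm _).diff (hAm _)) fun ω hω => ?_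
      obtain ⟨⟨m, hm, h⟩, hω'⟩ := hω
      -- On the difference of the two events the sum crosses `x` exactly at time `n + 1`; as `n + 1
      -- ≤ b`, the exponential there is at least `c`.
      have hm' : m = n + 1 := by
        by_contra hne
        exact hω' ⟨m, by omega, h⟩
      subst hm'
      refine ENNReal.ofReal_le_ofReal (Real.exp_le_exp.2 ?_)
      have h1 : l * x ≤ l * partialSum Y (n + 1) ω := mul_le_mul_of_nonneg_left h hl
      have h2 : ((n + 1 : ℕ) : ℝ) ≤ b := by exact_mod_cast hn
      have h3 := mul_le_mul_of_nonneg_right h2 (by positivity : 0 ≤ l ^ 2 / 2)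
      linarith
    calc c * P (A (n + 1)) + ∫⁻ ω in (A (n + 1))ᶜ, M (n + 1) ω ∂P
        = c * P (A n) + (c * P (A (n + 1) \ A n) + ∫⁻ ω in (A (n + 1))ᶜ, M (n + 1) ω ∂P) := by
          rw [hsplit, mul_add, add_assoc]
      _ ≤ c * P (A n) + ∫⁻ ω in (A n)ᶜ, M n ω ∂P := by
          gcongr
          refine le_trans ?_ hstep
          rw [hint]
          gcongr
      _ ≤ 1 := ih (by omega)

/-- Maximal inequality for sums of independent subgaussian variables. -/
lemma measure_exists_partialSum_ge_le [IsProbabilityMeasure P] (hY : ∀ i, Measurable (Y i))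
    (hind : iIndepFun Y P) (hsub : ∀ i, HasSubgaussianMGF (Y i) 1 P) {x : ℝ} (hx : 0 ≤ x) (b : ℕ) :
    P {ω | ∃ m ≤ b, x ≤ partialSum Y m ω} ≤ ENNReal.ofReal (Real.exp (-(x ^ 2 / (2 * b)))) := by
  rcases hx.eq_or_lt with rfl | hx
  · simpa using prob_le_one
  rcases b.eq_zero_or_pos with rfl | hb
  · simpa using prob_le_one
  have hb' : (0 : ℝ) < b := by exact_mod_cast hb
  -- The choice `l = x / b` maximizes `l x - b l² / 2`.
  have h := le_trans le_self_add (lintegral_stopped_exp_le_one hY hind hsub hx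
    (by positivity : 0 ≤ x / b) b b le_rfl)
  have he : x / b * x - b * ((x / b) ^ 2 / 2) = x ^ 2 / (2 * b) := by field_simp; ring
  rw [he] at h
  rw [Real.exp_neg, ENNReal.ofReal_inv_of_pos (Real.exp_pos _)]
  rw [ENNReal.le_inv_iff_mul_le, mul_comm]
  exact h

/-- Two-sided maximal inequality. -/
lemma measure_exists_abs_partialSum_ge_le [IsProbabilityMeasure P] (hY : ∀ i, Measurable (Y i))
    (hind : iIndepFun Y P) (hsub : ∀ i, HasSubgaussianMGF (Y i) 1 P) {x : ℝ} (hx : 0 ≤ x) (b : ℕ) :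
    P {ω | ∃ m ≤ b, x ≤ |partialSum Y m ω|} ≤
      2 * ENNReal.ofReal (Real.exp (-(x ^ 2 / (2 * b)))) := by
  have h1 := measure_exists_partialSum_ge_le hY hind hsub hx b
  have h2 := measure_exists_partialSum_ge_le (Y := fun i => -Y i) (fun i => (hY i).neg)
    (hind.comp (fun _ x => -x) (fun _ => measurable_neg)) (fun i => (hsub i).neg) hx b
  rw [two_mul]
  refine le_trans (measure_mono ?_) ((measure_union_le _ _).trans (add_le_add h1 h2))
  rintro ω ⟨m, hm, h⟩
  rcases le_abs.1 h with h | h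
  · exact Or.inl ⟨m, hm, h⟩
  · refine Or.inr ⟨m, hm, ?_⟩
    simpa [partialSum] using h

end Maximal

/-! ### Deterministic invariants of the counters. -/

section Counters

variable {N : ℕ}

/-- Relations between the counters of the algorithm that hold in every round. -/
structure State.Inv (σ : State N) : Prop where
  seen_le : ∀ a, σ.seen a ≤ σ.pulls a
  pulls_lt : ∀ a, σ.pulls a < 2 ^ σ.level a
  level_le : ∀ a, (σ.pulls a = 0 ∧ σ.level a = 0) ∨ 2 ^ σ.level a ≤ 2 * σ.seen a
  batches_eq : σ.batches = ∑ a, σ.level a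

lemma State.play_pulls (r : Refresh) (σ : State N) (a : Fin N) :
    (σ.play r a).pulls = Function.update σ.pulls a (σ.pulls a + 1) := by
  unfold State.play
  dsimp only
  split_ifs <;> rfl

lemma State.Inv.play {σ : State N} (h : σ.Inv) (r : Refresh) (a : Fin N) : (σ.play r a).Inv := by
  have hp := h.pulls_lt a
  have hs := h.seen_le a
  unfold State.play
  dsimp only
  split_ifs with hk
  · rw [Function.update_self] at hk
    refine ⟨fun b => ?_, fun b => ?_, fun b => ?_, h.batches_eq⟩
    · rcases eq_or_ne b a with rfl | hb
      · simp; omega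
      · simpa [hb] using h.seen_le b
    · rcases eq_or_ne b a with rfl | hb
      · simpa using hk
      · simpa [hb] using h.pulls_lt b
    · rcases eq_or_ne b a with rfl | hb
      · rcases h.level_le b with h0 | h0
        · simp [h0.2] at hk
        · exact Or.inr h0
      · simpa [hb] using h.level_le b
  · rw [Function.update_self] at hk
    refine ⟨fun b => ?_, fun b => ?_, fun b => ?_, ?_⟩
    · rcases eq_or_ne b a with rfl | hb
      · cases r <;> simp
      · cases r
        · simp
        · simpa [hb] using h.seen_le b
    · rcases eq_or_ne b a with rfl | hb
      · simp only [Function.update_self, pow_succ]; omega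
      · simpa [hb] using h.pulls_lt b
    · rcases eq_or_ne b a with rfl | hb
      · right
        cases r <;> simp only [Function.update_self, pow_succ] <;> omega
      · rcases h.level_le b with h0 | h0
        · left; simpa [hb] using h0
        · right
          have := h.seen_le b
          cases r <;> simp only [Function.update_of_ne hb] <;> omega
    · simp only [h.batches_eq]
      rw [Finset.sum_update_of_mem (Finset.mem_univ a),
        ← Finset.add_sum_erase _ _ (Finset.mem_univ a), Finset.sdiff_singleton_eq_erase]
      omega

variable (p : Params N) (x : Fin N → ℕ → ℝ) (z : ℕ → Fin N → ℝ)

lemma state_succ (t : ℕ) :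
    state p x z (t + 1) = (state p x z t).play p.refresh (arm p x z t) := rfl

lemma state_inv (t : ℕ) : (state p x z t).Inv := by
  induction t with
  | zero => exact ⟨fun _ => le_rfl, fun _ => by simp [state], fun _ => Or.inl ⟨rfl, rfl⟩,
      by simp [state]⟩
  | succ t ih => exact ih.play _ _

lemma pulls_eq_card (t : ℕ) (a : Fin N) :
    (state p x z t).pulls a = ((Finset.range t).filter fun s => arm p x z s = a).card := by
  induction t with
  | zero => simp [state]
  | succ t ih =>
    rw [state_succ, State.play_pulls, Finset.range_add_one, Finset.filter_insert]
    rcases eq_or_ne (arm p x z t) a with h | h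
    · simp [h, ih]
    · simp [h, h.symm, ih]

lemma pulls_le (t : ℕ) (a : Fin N) : (state p x z t).pulls a ≤ t := by
  rw [pulls_eq_card]
  exact (Finset.card_filter_le _ _).trans (by simp)

lemma pulls_lt_pulls {s t : ℕ} (h : s < t) :
    (state p x z s).pulls (arm p x z s) < (state p x z t).pulls (arm p x z s) := by
  rw [pulls_eq_card, pulls_eq_card]
  refine Finset.card_lt_card ⟨fun i hi => ?_, fun hsub => ?_⟩
  · simp only [Finset.mem_filter, Finset.mem_range] at hi ⊢
    exact ⟨hi.1.trans h, hi.2⟩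
  · simpa using hsub (show s ∈ _ by simp [h])

lemma arm_of_lt {t : ℕ} (h : t < N) : arm p x z t = ⟨t, h⟩ := by
  simp [arm, nextArm, h]

lemma pulls_pos {t : ℕ} (h : N ≤ t) (a : Fin N) : 0 < (state p x z t).pulls a := by
  rw [pulls_eq_card, Finset.card_pos]
  exact ⟨a, by simp [a.2.trans_le h, arm_of_lt p x z a.2]⟩

/-- A query triggered by `a` refreshes its estimate under either rule, and the next one comes no
later than when its pull count doubles. This is all the regret analysis uses about batching. -/
lemma pulls_lt_two_mul_seen {t : ℕ} (h : N ≤ t) (a : Fin N) :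
    (state p x z t).pulls a < 2 * (state p x z t).seen a := by
  have h1 := (state_inv p x z t).pulls_lt a
  have h2 := pulls_pos p x z h a
  rcases (state_inv p x z t).level_le a with h3 | h3 <;> omega

lemma seen_pos {t : ℕ} (h : N ≤ t) (a : Fin N) : 0 < (state p x z t).seen a := by
  have := pulls_lt_two_mul_seen p x z h a
  omega

/-- The number of batch queries in `t` rounds is at most `N (⌊log₂ t⌋ + 1)`. -/
lemma batches_le (t : ℕ) : (state p x z t).batches ≤ N * (Nat.log 2 t + 1) := by
  have hI := state_inv p x z t
  rw [hI.batches_eq]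
  refine (Finset.sum_le_card_nsmul _ _ (Nat.log 2 t + 1) fun a _ => ?_).trans (by simp)
  rcases hI.level_le a with h | h
  · omega
  · rcases Nat.eq_zero_or_pos ((state p x z t).level a) with h0 | h0
    · omega
    · have h1 := hI.seen_le a
      have h2 := pulls_le p x z t a
      obtain ⟨m, hm⟩ := Nat.exists_eq_succ_of_ne_zero h0.ne'
      rw [hm, pow_succ] at h
      have : m ≤ Nat.log 2 t := Nat.le_log_of_pow_le (by norm_num) (by omega)
      omega

/-- A sum over the rounds from `N` on in which arm `a` is played of a quantity that depends on the
number of rewards seen is at most the sum, over the possible pull counts `k`, of the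
largest value of that quantity over the numbers compatible with `k`. -/
lemma sum_arm_le_sum_iSup (T : ℕ) (a : Fin N) (f : ℕ → ℝ≥0∞) :
    ∑ t ∈ Finset.Ico N T, (if arm p x z t = a then f ((state p x z t).seen a) else 0) ≤
      ∑ k ∈ Finset.Icc 1 T, ⨆ n ∈ Finset.Ioc (k / 2) k, f n := by
  rw [← Finset.sum_filter]
  set I := (Finset.Ico N T).filter fun t => arm p x z t = a
  have hle : ∀ t ∈ I, f ((state p x z t).seen a) ≤
      ⨆ n ∈ Finset.Ioc ((state p x z t).pulls a / 2) ((state p x z t).pulls a), f n := by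
    intro t ht
    simp only [I, Finset.mem_filter, Finset.mem_Ico] at ht
    have h1 := pulls_lt_two_mul_seen p x z ht.1.1 a
    have h2 := (state_inv p x z t).seen_le a
    exact le_iSup₂_of_le _ (by rw [Finset.mem_Ioc]; omega) le_rfl
  refine (Finset.sum_le_sum hle).trans ?_
  -- Every play of `a` raises its pull count, so each value of the count is charged by at most one
  -- round.
  have hinj : Set.InjOn (fun t => (state p x z t).pulls a) I := fun s hs t ht hst => by
    simp only [I, Finset.coe_filter, Set.mem_ofPred_eq] at hs ht
    rcases lt_trichotomy s t with h | h | h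
    · have := pulls_lt_pulls p x z h
      rw [hs.2] at this
      exact absurd hst this.ne
    · exact h
    · have := pulls_lt_pulls p x z h
      rw [ht.2] at this
      exact absurd hst this.ne'
  rw [← Finset.sum_image (f := fun k => ⨆ n ∈ Finset.Ioc (k / 2) k, f n) hinj]
  refine Finset.sum_le_sum_of_subset fun k hk => ?_
  simp only [I, Finset.mem_image, Finset.mem_filter, Finset.mem_Ico] at hk
  obtain ⟨t, ht, rfl⟩ := hk
  have h1 := pulls_le p x z t a
  have h2 := pulls_pos p x z ht.1.1 a
  rw [Finset.mem_Icc]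
  omega

end Counters

/-! ### Geometric and condensed exponential sums. -/

section Sums

lemma tsum_exp_neg_le {a : ℝ} (ha : 0 < a) :
    ∑' k : ℕ, ENNReal.ofReal (Real.exp (-((k + 1 : ℕ) * a))) ≤ ENNReal.ofReal (1 / a) := by
  have h1 : Real.exp (-a) < 1 := by simpa using ha
  have h0 := (Real.exp_pos (-a)).le
  have hterm : ∀ k : ℕ, Real.exp (-((k + 1 : ℕ) * a)) = Real.exp (-a) * Real.exp (-a) ^ k := by
    intro k
    rw [← pow_succ', ← Real.exp_nat_mul]
    congr 1; ring
  simp_rw [hterm]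
  have hs : Summable fun k : ℕ => Real.exp (-a) * Real.exp (-a) ^ k :=
    (summable_geometric_of_lt_one h0 h1).mul_left _
  rw [← ENNReal.ofReal_tsum_of_nonneg (fun k => by positivity) hs]
  apply ENNReal.ofReal_le_ofReal
  rw [tsum_mul_left, tsum_geometric_of_lt_one h0 h1, ← div_eq_mul_inv,
    div_le_div_iff₀ (by linarith) ha]
  have h2 : (1 + a) * Real.exp (-a) ≤ Real.exp a * Real.exp (-a) := by
    gcongr; linarith [Real.add_one_le_exp a]
  rw [← Real.exp_add, add_neg_cancel, Real.exp_zero] at h2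
  linarith

lemma sum_Icc_exp_neg_le {a : ℝ} (ha : 0 < a) (T : ℕ) :
    ∑ k ∈ Finset.Icc 1 T, ENNReal.ofReal (Real.exp (-(k * a))) ≤ ENNReal.ofReal (1 / a) := by
  refine le_trans ?_ (tsum_exp_neg_le ha)
  rw [← Finset.Ico_add_one_right_eq_Icc, Finset.sum_Ico_eq_sum_range]
  simp_rw [add_comm 1, Nat.add_sub_cancel]
  exact ENNReal.sum_le_tsum _

/-- Cauchy condensation reduces the dyadic sum to a geometric series. The value at `0` is set to
zero so that it does not enter the bound. -/
lemma tsum_two_pow_mul_exp_le {a : ℝ} (ha : 0 < a) :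
    ∑' j : ℕ, 2 ^ j * ENNReal.ofReal (Real.exp (-((2 ^ j : ℕ) * a))) ≤
      3 * ENNReal.ofReal (1 / a) := by
  set f : ℕ → ℝ≥0∞ := fun k => if k = 0 then 0 else ENNReal.ofReal (Real.exp (-(k * a))) with hf
  have h := ENNReal.tsum_condensed_le (f := f) (fun {m n} hm hmn => by
    have h1 : m ≠ 0 := by omega
    have h2 : n ≠ 0 := by omega
    simp only [hf, h1, h2, if_false]
    gcongr)
  have hsum : ∑' k, f k ≤ ENNReal.ofReal (1 / a) := by
    rw [tsum_eq_zero_add' ENNReal.summable]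
    simpa [hf] using tsum_exp_neg_le ha
  calc _ = ∑' j : ℕ, 2 ^ j * f (2 ^ j) := by simp [hf]
    _ ≤ f 1 + 2 * ∑' k, f k := h
    _ ≤ ∑' k, f k + 2 * ∑' k, f k := by gcongr; exact ENNReal.le_tsum 1
    _ = 3 * ∑' k, f k := by ring
    _ ≤ _ := by gcongr

end Sums

/-! ### Exponential moments of normalized sums, uniform over a block. -/

section Tails

variable {Ω : Type*} [MeasurableSpace Ω] {P : Measure Ω} [IsProbabilityMeasure P] {Y : ℕ → Ω → ℝ}

/-- Tail bound, uniform over `k / 2 < n ≤ k`, for the square of the normalized partial sums. The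
range is cut into `J` pieces, which makes the exponent as close to `-x / 2` as desired. -/
lemma measure_exists_sq_partialSum_ge_le (hY : ∀ i, Measurable (Y i)) (hind : iIndepFun Y P)
    (hsub : ∀ i, HasSubgaussianMGF (Y i) 1 P) {x : ℝ} (hx : 0 ≤ x) {J : ℕ} (hJ : 0 < J) {k : ℕ}
    (hk : 0 < k) :
    P {ω | ∃ n ∈ Finset.Ioc (k / 2) k, x ≤ partialSum Y n ω ^ 2 / n} ≤
      J * (2 * ENNReal.ofReal (Real.exp (-(x * (J / (2 * (J + 1))))))) := by
  -- Piece `j` consists of the `n` between `(J + j) k / (2J)` and `(J + j + 1) k / (2J)`. The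
  -- threshold is taken at the left end and the variance at the right end; their ratio is at least
  -- `J / (J + 1)`.
  set b : ℕ → ℕ := fun j => (J + j + 1) * k / (2 * J) with hb
  set y : ℕ → ℝ := fun j => √(x * ((J + j) * k / (2 * J))) with hy
  set B : ℕ → Set Ω := fun j => {ω | ∃ n ≤ b j, 0 < n ∧ y j ≤ |partialSum Y n ω|} with hB
  have hJ' : (0 : ℝ) < J := by exact_mod_cast hJ
  have hk' : (0 : ℝ) < k := by exact_mod_cast hk
  have hcover : {ω | ∃ n ∈ Finset.Ioc (k / 2) k, x ≤ partialSum Y n ω ^ 2 / n} ⊆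
      ⋃ j ∈ Finset.range J, B j := by
    rintro ω ⟨n, hn, h⟩
    rw [Finset.mem_Ioc] at hn
    have hkn : k < 2 * n := by omega
    obtain ⟨d, hd⟩ : ∃ d, 2 * n = k + (d + 1) := ⟨2 * n - k - 1, by omega⟩
    -- Subtracting `1` makes the pieces closed on the right, so that `n = k` falls into the last
    -- piece rather than beyond it.
    set e := J * (d + 1) - 1 with he
    have he1 : e + 1 = J * (d + 1) := by
      have : 0 < J * (d + 1) := by positivity
      omega
    have hdk : d + 1 ≤ k := by omega
    have h1 : e / k * k ≤ e := Nat.div_mul_le_self _ _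
    have h2 : e < (e / k + 1) * k := by
      have := Nat.lt_mul_div_succ e hk
      rwa [mul_comm] at this
    have h3 : e / k < J := by
      rw [Nat.div_lt_iff_lt_mul hk]
      have := Nat.mul_le_mul_left J hdk
      omega
    have hn2 : n * (2 * J) = J * k + J * (d + 1) := by
      rw [← mul_add, ← hd, mul_comm, mul_comm 2 J, mul_assoc]
    have hlow : (J + e / k) * k ≤ n * (2 * J) := by
      rw [hn2, add_mul]; omega
    have hup : n * (2 * J) ≤ (J + e / k + 1) * k := by
      rw [hn2, add_assoc, add_mul]; omega
    simp only [Set.mem_iUnion, Finset.mem_range]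
    refine ⟨e / k, h3, n, ?_, by omega, ?_⟩
    · rw [hb]; dsimp only
      rw [Nat.le_div_iff_mul_le (by omega)]
      exact hup
    · apply Real.sqrt_le_iff.2 ⟨abs_nonneg _, ?_⟩
      have hn' : (0 : ℝ) < n := by
        have : 0 < n := by omega
        exact_mod_cast this
      rw [sq_abs]
      rw [le_div_iff₀ hn'] at h
      refine le_trans (mul_le_mul_of_nonneg_left ?_ hx) h
      rw [div_le_iff₀ (by positivity)]
      exact_mod_cast hlow
  have hbound : ∀ j ∈ Finset.range J,
      P (B j) ≤ 2 * ENNReal.ofReal (Real.exp (-(x * (J / (2 * (J + 1)))))) := fun j _ => by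
    rcases Nat.eq_zero_or_pos (b j) with h0 | h0
    · have : B j = ∅ := by
        ext ω
        simp only [hB, h0, Set.mem_ofPred_eq, Set.mem_empty_iff_false, iff_false]
        rintro ⟨n, h1, h2, -⟩
        omega
      simp [this]
    have hb0 : (0 : ℝ) < b j := by exact_mod_cast h0
    have hble : (b j : ℝ) ≤ (J + j + 1) * k / (2 * J) := by
      refine (Nat.cast_div_le).trans ?_
      push_cast; exact le_rfl
    refine (measure_mono ?_).trans
      ((measure_exists_abs_partialSum_ge_le hY hind hsub
        (Real.sqrt_nonneg (x * ((J + j) * k / (2 * J)))) (b j)).trans ?_)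
    · rintro ω ⟨n, h1, -, h2⟩
      exact ⟨n, h1, h2⟩
    · gcongr
      rw [Real.sq_sqrt (by positivity), le_div_iff₀ (by positivity)]
      calc x * (J / (2 * (J + 1))) * (2 * b j)
          ≤ x * (J / (2 * (J + 1))) * (2 * ((J + j + 1) * k / (2 * J))) := by gcongr
        _ ≤ x * ((J + j) * k / (2 * J)) := by
          have : (J : ℝ) / (2 * (J + 1)) * (2 * ((J + j + 1) * k / (2 * J))) ≤
            (J + j) * k / (2 * J) := by
            rw [div_mul_eq_mul_div, div_le_div_iff₀ (by positivity) (by positivity)]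
            have hj : (0 : ℝ) ≤ j := by positivity
            field_simp
            nlinarith
          rw [mul_assoc]
          exact mul_le_mul_of_nonneg_left this hx
  calc P _ ≤ P (⋃ j ∈ Finset.range J, B j) := measure_mono hcover
    _ ≤ ∑ j ∈ Finset.range J, P (B j) := measure_biUnion_finset_le _ _
    _ ≤ _ := by
      refine (Finset.sum_le_card_nsmul _ _ _ hbound).trans ?_
      simp

/-- Bound for the expectation of `sup exp (β Sₙ² / (2 n))` over `k / 2 < n ≤ k`. -/
noncomputable def expSupConst (β : ℝ) (J : ℕ) : ℝ≥0∞ :=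
  ∑' j : ℕ, ENNReal.ofReal (Real.exp (β * (j + 1) / 2)) *
    (J * (2 * ENNReal.ofReal (Real.exp (-(j * (J / (2 * (J + 1))))))))

/-- The series is geometric with ratio `exp ((β - J / (J + 1)) / 2)`. -/
lemma expSupConst_ne_top {β : ℝ} {J : ℕ} (h : β < J / (J + 1)) : expSupConst β J ≠ ∞ := by
  have hterm : ∀ j : ℕ, ENNReal.ofReal (Real.exp (β * (j + 1) / 2)) *
      (J * (2 * ENNReal.ofReal (Real.exp (-(j * (J / (2 * (J + 1)))))))) =
      (J * 2 * ENNReal.ofReal (Real.exp (β / 2))) *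
        ENNReal.ofReal (Real.exp ((β - J / (J + 1)) / 2)) ^ j := fun j => by
    rw [← ENNReal.ofReal_pow (Real.exp_pos _).le, mul_assoc,
      ← ENNReal.ofReal_mul (Real.exp_pos _).le, mul_left_comm, mul_left_comm _ 2,
      ← ENNReal.ofReal_mul (Real.exp_pos _).le, mul_assoc, ← Real.exp_nat_mul, ← Real.exp_add, ← Real.exp_add]
    congr 4
    field_simp
    ring
  unfold expSupConst
  simp_rw [hterm]
  rw [ENNReal.tsum_mul_left, ENNReal.tsum_geometric]
  refine ENNReal.mul_ne_top
    (ENNReal.mul_ne_top (ENNReal.mul_ne_top (by simp) (by simp)) (by simp)) ?_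
  rw [Ne, ENNReal.inv_eq_top, tsub_eq_zero_iff_le, not_le, ← ENNReal.ofReal_one,
    ENNReal.ofReal_lt_ofReal_iff one_pos, Real.exp_lt_one_iff]
  linarith

/-- Slicing by the integer part of `S_n² / n` turns the tail bound into a bound for the expectation,
uniform in `k`. -/
lemma lintegral_iSup_exp_le (hY : ∀ i, Measurable (Y i)) (hind : iIndepFun Y P)
    (hsub : ∀ i, HasSubgaussianMGF (Y i) 1 P) {β : ℝ} (hβ : 0 ≤ β) {J : ℕ} (hJ : 0 < J) {k : ℕ}
    (hk : 0 < k) :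
    ∫⁻ ω, ⨆ n ∈ Finset.Ioc (k / 2) k,
        ENNReal.ofReal (Real.exp (β * (partialSum Y n ω ^ 2 / n) / 2)) ∂P
      ≤ expSupConst β J := by
  set E : ℕ → Set Ω := fun j => {ω | ∃ n ∈ Finset.Ioc (k / 2) k, (j : ℝ) ≤ partialSum Y n ω ^ 2 / n}
    with hE
  have hEm : ∀ j, MeasurableSet (E j) := fun j => by
    have : E j = ⋃ n ∈ Finset.Ioc (k / 2) k, {ω | (j : ℝ) ≤ partialSum Y n ω ^ 2 / n} := by
      ext; simp [hE]
    rw [this]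
    refine Finset.measurableSet_biUnion _ fun n _ => ?_
    exact measurableSet_le measurable_const (((measurable_partialSum hY n).pow_const 2).div_const _)
  have hpt : ∀ ω, ⨆ n ∈ Finset.Ioc (k / 2) k,
      ENNReal.ofReal (Real.exp (β * (partialSum Y n ω ^ 2 / n) / 2)) ≤
      ∑' j : ℕ, (E j).indicator (fun _ => ENNReal.ofReal (Real.exp (β * (j + 1) / 2))) ω := by
    intro ω
    refine iSup₂_le fun n hn => ?_
    have h0 : 0 ≤ partialSum Y n ω ^ 2 / n := by positivity
    refine le_trans ?_ (ENNReal.le_tsum ⌊partialSum Y n ω ^ 2 / n⌋₊)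
    rw [Set.indicator_of_mem (show ω ∈ E _ from ⟨n, hn, Nat.floor_le h0⟩)]
    have := (Nat.lt_floor_add_one (partialSum Y n ω ^ 2 / n)).le
    gcongr
  refine (lintegral_mono hpt).trans ?_
  rw [lintegral_tsum fun j => (measurable_const.indicator (hEm j)).aemeasurable]
  refine ENNReal.tsum_le_tsum fun j => ?_
  rw [lintegral_indicator_const (hEm j)]
  gcongr
  exact measure_exists_sq_partialSum_ge_le hY hind hsub (Nat.cast_nonneg j) hJ hk

end Tails

/-! ### Deviations of the clipping level in both directions. -/

section Clip

variable {Ω : Type*} [MeasurableSpace Ω] {P : Measure Ω} [IsProbabilityMeasure P] {Y : ℕ → Ω → ℝ}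

lemma exp_neg_posLog_le {u : ℝ} (hu : 0 < u) : Real.exp (-Real.posLog u) ≤ 1 / u := by
  rw [one_div, ← Real.exp_log (inv_pos.2 hu), Real.exp_le_exp, Real.log_inv, neg_le_neg_iff]
  exact le_max_right _ _

/-- The clipping level of an arm is unlikely to be much below its mean. -/
lemma measure_exists_clip_le (hY : ∀ i, Measurable (Y i)) (hind : iIndepFun Y P)
    (hsub : ∀ i, HasSubgaussianMGF (Y i) 1 P) {α : ℝ} (hα : 4 ≤ α) {N T : ℕ} (hN : 0 < N)
    (hT : 0 < T) {δ : ℝ} (hδ : 0 < δ) :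
    P {ω | ∃ n ∈ Finset.Icc 1 T,
        partialSum Y n ω / n + √(α / n * Real.posLog ((T : ℝ) / (n * N))) ≤ -δ} ≤
      ENNReal.ofReal (24 * N / (T * δ ^ 2)) := by
  have hN' : (0 : ℝ) < N := by exact_mod_cast hN
  have hT' : (0 : ℝ) < T := by exact_mod_cast hT
  set l : ℕ → ℝ := fun j => Real.posLog ((T : ℝ) / (2 ^ (j + 1) * N)) with hl
  have hl0 : ∀ j, 0 ≤ l j := fun j => Real.posLog_nonneg
  -- On `2^j ≤ n < 2^(j+1)`, failure forces `-S_n` to be at least `nδ` plus `n` times the clipping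
  -- radius. The factor `n` is bounded below at the left end of the block, the logarithm at the
  -- right end.
  set y : ℕ → ℝ := fun j => 2 ^ j * δ + √(α * 2 ^ j * l j) with hy
  have hy0 : ∀ j, 0 ≤ y j := fun j => by positivity
  set Y' : ℕ → Ω → ℝ := fun i => -Y i with hY'
  set B : ℕ → Set Ω := fun j => {ω | ∃ n ≤ 2 ^ (j + 1), y j ≤ partialSum Y' n ω} with hB
  have hcover : {ω | ∃ n ∈ Finset.Icc 1 T,
      partialSum Y n ω / n + √(α / n * Real.posLog ((T : ℝ) / (n * N))) ≤ -δ} ⊆ ⋃ j, B j := by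
    rintro ω ⟨n, hn, h⟩
    rw [Finset.mem_Icc] at hn
    have hn' : (0 : ℝ) < n := by exact_mod_cast hn.1
    have h1 : 2 ^ Nat.log 2 n ≤ n := Nat.pow_log_le_self 2 (by omega)
    have h2 : n < 2 ^ (Nat.log 2 n + 1) := Nat.lt_pow_succ_log_self (by norm_num) n
    have h1' : (2 : ℝ) ^ Nat.log 2 n ≤ n := by exact_mod_cast h1
    have h2' : (n : ℝ) ≤ 2 ^ (Nat.log 2 n + 1) := by exact_mod_cast h2.le
    refine Set.mem_iUnion.2 ⟨Nat.log 2 n, n, h2.le, ?_⟩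
    have hneg : partialSum Y' n ω = -partialSum Y n ω := by simp [partialSum, hY']
    have hroot : √(α * 2 ^ Nat.log 2 n * l (Nat.log 2 n)) ≤
        n * √(α / n * Real.posLog ((T : ℝ) / (n * N))) := by
      have : (n : ℝ) * √(α / n * Real.posLog ((T : ℝ) / (n * N))) =
          √(α * n * Real.posLog ((T : ℝ) / (n * N))) := by
        rw [← Real.sqrt_sq hn'.le, ← Real.sqrt_mul (by positivity), Real.sqrt_sq hn'.le]
        congr 1
        field_simp
      rw [this]
      apply Real.sqrt_le_sqrt
      have : l (Nat.log 2 n) ≤ Real.posLog ((T : ℝ) / (n * N)) :=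
        Real.posLog_le_posLog (by positivity) (by gcongr)
      have := hl0 (Nat.log 2 n)
      gcongr
    have h3 : (n : ℝ) * (partialSum Y n ω / n + √(α / n * Real.posLog ((T : ℝ) / (n * N))))
        ≤ n * -δ := by gcongr
    rw [mul_add, mul_div_cancel₀ _ hn'.ne'] at h3
    have h4 : (2 : ℝ) ^ Nat.log 2 n * δ ≤ n * δ := by gcongr
    rw [hneg]
    simp only [hy]
    linarith
  have hbound : ∀ j, P (B j) ≤ ENNReal.ofReal (2 * N / T) *
      (2 ^ j * ENNReal.ofReal (Real.exp (-((2 ^ j : ℕ) * (δ ^ 2 / 4))))) := fun j => by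
    refine (measure_exists_partialSum_ge_le (Y := Y') (fun i => (hY i).neg)
      (hind.comp (fun _ x => -x) (fun _ => measurable_neg)) (fun i => (hsub i).neg) (hy0 j)
      (2 ^ (j + 1))).trans ?_
    have e1 : (2 : ℝ≥0∞) ^ j = ENNReal.ofReal (2 ^ j) := by
      rw [ENNReal.ofReal_pow (by norm_num)]; simp
    rw [e1, ← ENNReal.ofReal_mul (by positivity), ← ENNReal.ofReal_mul (by positivity)]
    apply ENNReal.ofReal_le_ofReal
    -- After the cross term of `y j ^ 2` is dropped, `α ≥ 4` gives `l j` coefficient at least one.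
    -- Then `exp (-l j)` supplies the full factor `2^(j+1) N / T`.
    have hsq : 2 ^ j * (δ ^ 2 / 4) + l j ≤ y j ^ 2 / (2 * (2 ^ (j + 1) : ℕ)) := by
      rw [le_div_iff₀ (by positivity)]
      have h1 : √(α * 2 ^ j * l j) ^ 2 = α * 2 ^ j * l j :=
        Real.sq_sqrt (by have := hl0 j; positivity)
      have h2 : 0 ≤ 2 ^ j * δ * √(α * 2 ^ j * l j) := by positivity
      have h3 : 4 * 2 ^ j * l j ≤ α * 2 ^ j * l j := by have := hl0 j; gcongr
      simp only [hy]
      push_cast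
      rw [pow_succ (2 : ℝ) j]
      nlinarith
    have hexp : Real.exp (-l j) ≤ 2 ^ (j + 1) * N / T := by
      refine (exp_neg_posLog_le (by positivity)).trans (le_of_eq ?_)
      rw [one_div_div]
    calc Real.exp (-(y j ^ 2 / (2 * (2 ^ (j + 1) : ℕ))))
        ≤ Real.exp (-(2 ^ j * (δ ^ 2 / 4) + l j)) := by gcongr
      _ = Real.exp (-(2 ^ j * (δ ^ 2 / 4))) * Real.exp (-l j) := by rw [← Real.exp_add]; ring_nf
      _ ≤ Real.exp (-(2 ^ j * (δ ^ 2 / 4))) * (2 ^ (j + 1) * N / T) := by gcongr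
      _ = 2 * N / T * (2 ^ j * Real.exp (-((2 ^ j : ℕ) * (δ ^ 2 / 4)))) := by
        push_cast; ring
  calc P _ ≤ P (⋃ j, B j) := measure_mono hcover
    _ ≤ ∑' j, P (B j) := measure_iUnion_le _
    _ ≤ _ := ENNReal.tsum_le_tsum hbound
    _ ≤ ENNReal.ofReal (2 * N / T) * (3 * ENNReal.ofReal (1 / (δ ^ 2 / 4))) := by
      rw [ENNReal.tsum_mul_left]
      gcongr
      exact tsum_two_pow_mul_exp_le (by positivity)
    _ = ENNReal.ofReal (24 * N / (T * δ ^ 2)) := by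
      have : (3 : ℝ≥0∞) = ENNReal.ofReal 3 := by simp
      rw [this, ← ENNReal.ofReal_mul (by positivity), ← ENNReal.ofReal_mul (by positivity)]
      congr 1
      field_simp
      norm_num

/-- The expected number of pull counts at which the clipping level of an arm can exceed its mean by
more than `δ`. -/
lemma sum_measure_exists_clip_gt_le (hY : ∀ i, Measurable (Y i)) (hind : iIndepFun Y P)
    (hsub : ∀ i, HasSubgaussianMGF (Y i) 1 P) {α : ℝ} (hα : 0 ≤ α) {N T : ℕ} (hN : 0 < N)
    {δ : ℝ} (hδ : 0 < δ) :
    ∑ k ∈ Finset.Icc 1 T, P {ω | ∃ n ∈ Finset.Ioc (k / 2) k,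
        δ < partialSum Y n ω / n + √(α / n * Real.posLog ((T : ℝ) / (n * N)))} ≤
      ENNReal.ofReal ((8 * α * Real.posLog (T * δ ^ 2 / N) + 34) / δ ^ 2) := by
  have hN' : (0 : ℝ) < N := by exact_mod_cast hN
  set L := Real.posLog (T * δ ^ 2 / N) with hL
  have hL0 : 0 ≤ L := Real.posLog_nonneg
  -- For `k > K` every compatible `n` has `n δ² ≥ 4αL + 1`. The summand `1` bounds the logarithm by
  -- `L`; the summand `4αL` then bounds the clipping radius by `δ / 2`, leaving a deviation `S_n ≥
  -- nδ/2 ≥ kδ/4`.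
  set K := 2 * (4 * α * L + 1) / δ ^ 2 with hK
  have hK0 : 0 ≤ K := by positivity
  have hterm : ∀ k ∈ Finset.Icc 1 T, P {ω | ∃ n ∈ Finset.Ioc (k / 2) k,
        δ < partialSum Y n ω / n + √(α / n * Real.posLog ((T : ℝ) / (n * N)))} ≤
      (if (k : ℝ) ≤ K then 1 else 0) + ENNReal.ofReal (Real.exp (-(k * (δ ^ 2 / 32)))) := by
    intro k hk
    rw [Finset.mem_Icc] at hk
    have hk' : (0 : ℝ) < k := by exact_mod_cast hk.1
    split_ifs with hkK
    · exact prob_le_one.trans le_self_add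
    rw [zero_add]
    push Not at hkK
    have hmax := measure_exists_partialSum_ge_le hY hind hsub (x := k * δ / 4) (by positivity) k
    have he : (k * δ / 4) ^ 2 / (2 * k) = k * (δ ^ 2 / 32) := by field_simp; norm_num
    rw [he] at hmax
    refine (measure_mono ?_).trans hmax
    rintro ω ⟨n, hn, h⟩
    rw [Finset.mem_Ioc] at hn
    refine ⟨n, hn.2, ?_⟩
    have hn' : (0 : ℝ) < n := by
      have : 0 < n := by omega
      exact_mod_cast this
    have hkn : (k : ℝ) < 2 * n := by
      have : k < 2 * n := by omega
      exact_mod_cast this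
    have hn0 : 4 * α * L + 1 ≤ n * δ ^ 2 := by
      have : K < 2 * n := hkK.trans hkn
      rw [hK, div_lt_iff₀ (by positivity)] at this
      linarith
    have hlog : Real.posLog ((T : ℝ) / (n * N)) ≤ L := by
      refine Real.posLog_le_posLog (by positivity) ?_
      rw [div_le_div_iff₀ (by positivity) hN']
      have : 1 ≤ n * δ ^ 2 := by
        have : 0 ≤ 4 * α * L := by positivity
        linarith
      calc (T : ℝ) * N = T * N * 1 := by ring
        _ ≤ T * N * (n * δ ^ 2) := by gcongr
        _ = _ := by ring
    have hroot : √(α / n * Real.posLog ((T : ℝ) / (n * N))) ≤ δ / 2 := by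
      rw [Real.sqrt_le_left (by positivity)]
      calc α / n * Real.posLog ((T : ℝ) / (n * N)) ≤ α / n * L := by gcongr
        _ ≤ (δ / 2) ^ 2 := by
          rw [div_mul_eq_mul_div, div_le_iff₀ hn']
          linarith
    have h1 : δ / 2 ≤ partialSum Y n ω / n := by linarith
    rw [le_div_iff₀ hn'] at h1
    nlinarith
  refine (Finset.sum_le_sum hterm).trans ?_
  rw [Finset.sum_add_distrib]
  have hcount : ∑ k ∈ Finset.Icc 1 T, (if (k : ℝ) ≤ K then (1 : ℝ≥0∞) else 0) ≤
      ENNReal.ofReal K := by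
    rw [Finset.sum_boole]
    calc (((Finset.Icc 1 T).filter fun k : ℕ => (k : ℝ) ≤ K).card : ℝ≥0∞)
        ≤ ((Finset.Icc 1 ⌊K⌋₊).card : ℝ≥0∞) := by
          refine Nat.cast_le.2 (Finset.card_le_card fun k hk => ?_)
          simp only [Finset.mem_filter, Finset.mem_Icc] at hk ⊢
          exact ⟨hk.1.1, Nat.le_floor hk.2⟩
      _ = (⌊K⌋₊ : ℝ≥0∞) := by simp
      _ = ENNReal.ofReal (⌊K⌋₊ : ℝ) := by simp
      _ ≤ ENNReal.ofReal K := ENNReal.ofReal_le_ofReal (Nat.floor_le hK0)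
  refine (add_le_add hcount (sum_Icc_exp_neg_le (by positivity) T)).trans ?_
  rw [← ENNReal.ofReal_add hK0 (by positivity)]
  apply ENNReal.ofReal_le_ofReal
  rw [hK]
  apply le_of_eq
  field_simp
  ring

end Clip

/-! ### Gaussian odds and their expected sum over pull counts. -/

section Gaussian

/-- Odds that a standard normal number is at most `w`. -/
noncomputable def gaussOdds (w : ℝ) : ℝ≥0∞ :=
  gaussianReal 0 1 (Set.Iic w) / gaussianReal 0 1 (Set.Ioi w)

/-- The density is integrated over `(w, w + 1]` only. Replacing `w` by `w + 1` in the exponent is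
harmless, since the slack between `ρ` and `1` absorbs it later. -/
lemma gaussianReal_Ioi_ge {w : ℝ} (hw : 0 ≤ w) :
    ENNReal.ofReal ((√(2 * Real.pi))⁻¹ * Real.exp (-((w + 1) ^ 2 / 2))) ≤
      gaussianReal 0 1 (Set.Ioi w) := by
  calc ENNReal.ofReal ((√(2 * Real.pi))⁻¹ * Real.exp (-((w + 1) ^ 2 / 2)))
      = ∫⁻ _ in Set.Ioc w (w + 1),
          ENNReal.ofReal ((√(2 * Real.pi))⁻¹ * Real.exp (-((w + 1) ^ 2 / 2))) := by
        simp
    _ ≤ ∫⁻ y in Set.Ioc w (w + 1), gaussianPDF 0 1 y := by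
        refine setLIntegral_mono' measurableSet_Ioc fun y hy => ?_
        unfold gaussianPDF gaussianPDFReal
        apply ENNReal.ofReal_le_ofReal
        simp only [NNReal.coe_one, mul_one, sub_zero, neg_div]
        have h1 : 0 ≤ y := hw.trans hy.1.le
        have h2 := hy.2
        gcongr
    _ = gaussianReal 0 1 (Set.Ioc w (w + 1)) := (gaussianReal_apply 0 one_ne_zero _).symm
    _ ≤ _ := measure_mono Set.Ioc_subset_Ioi_self

lemma gaussianReal_Ioi_pos (w : ℝ) : gaussianReal 0 1 (Set.Ioi w) ≠ 0 := by
  have h := gaussianReal_Ioi_ge (le_max_right w 0)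
  have h2 : gaussianReal 0 1 (Set.Ioi (max w 0)) ≤ gaussianReal 0 1 (Set.Ioi w) :=
    measure_mono (Set.Ioi_subset_Ioi (le_max_left _ _))
  refine ((ENNReal.ofReal_pos.2 ?_).trans_le (h.trans h2)).ne'
  positivity

lemma hasSubgaussianMGF_id_gaussianReal :
    HasSubgaussianMGF (fun y : ℝ => y) 1 (gaussianReal 0 1) where
  integrable_exp_mul t := integrable_exp_mul_gaussianReal t
  mgf_le t := by rw [mgf_fun_id_gaussianReal]; simp

lemma gaussianReal_Iic_le {w : ℝ} (hw : w ≤ 0) :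
    gaussianReal 0 1 (Set.Iic w) ≤ ENNReal.ofReal (Real.exp (-(w ^ 2 / 2))) := by
  have h := (hasSubgaussianMGF_id_gaussianReal.neg).measure_ge_le (neg_nonneg.2 hw)
  have hs : {y : ℝ | -w ≤ (-fun y : ℝ => y) y} = Set.Iic w := by ext; simp
  rw [hs, measureReal_def] at h
  rw [← ENNReal.ofReal_toReal (measure_ne_top (gaussianReal 0 1) (Set.Iic w))]
  refine ENNReal.ofReal_le_ofReal (h.trans (le_of_eq ?_))
  simp [neg_div]

lemma gaussOdds_le_of_nonneg {w v : ℝ} (hv : 0 ≤ v) (hwv : w ≤ v) :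
    gaussOdds w ≤ ENNReal.ofReal (√(2 * Real.pi) * Real.exp ((v + 1) ^ 2 / 2)) := by
  have h1 : gaussianReal 0 1 (Set.Ioi v) ≤ gaussianReal 0 1 (Set.Ioi w) :=
    measure_mono (Set.Ioi_subset_Ioi hwv)
  have hpos : 0 < (√(2 * Real.pi))⁻¹ * Real.exp (-((v + 1) ^ 2 / 2)) := by positivity
  calc gaussOdds w ≤ 1 / ENNReal.ofReal ((√(2 * Real.pi))⁻¹ * Real.exp (-((v + 1) ^ 2 / 2))) :=
        ENNReal.div_le_div prob_le_one ((gaussianReal_Ioi_ge hv).trans h1)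
    _ = _ := by
      rw [one_div, ← ENNReal.ofReal_inv_of_pos hpos, mul_inv, inv_inv, Real.exp_neg, inv_inv]

lemma gaussOdds_le_of_nonpos {w : ℝ} (hw : w ≤ 0) :
    gaussOdds w ≤ ENNReal.ofReal (√(2 * Real.pi) * Real.exp (1 / 2) * Real.exp (-(w ^ 2 / 2))) := by
  have h1 : gaussianReal 0 1 (Set.Ioi 0) ≤ gaussianReal 0 1 (Set.Ioi w) :=
    measure_mono (Set.Ioi_subset_Ioi hw)
  have h2 := (gaussianReal_Ioi_ge le_rfl).trans h1
  have hpos : 0 < (√(2 * Real.pi))⁻¹ * Real.exp (-(((0 : ℝ) + 1) ^ 2 / 2)) := by positivity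
  calc gaussOdds w ≤ ENNReal.ofReal (Real.exp (-(w ^ 2 / 2))) /
      ENNReal.ofReal ((√(2 * Real.pi))⁻¹ * Real.exp (-(((0 : ℝ) + 1) ^ 2 / 2))) :=
        ENNReal.div_le_div (gaussianReal_Iic_le hw) h2
    _ = _ := by
      rw [← ENNReal.ofReal_div_of_pos hpos]
      congr 1
      rw [Real.exp_neg (((0 : ℝ) + 1) ^ 2 / 2)]
      norm_num
      field_simp

/-- The odds that the sample of an arm stays `ε` below its mean, when its estimate based on `n`
rewards is off by `d`. -/
lemma gaussOdds_sample_le {ρ : ℝ} (hρ : 0 < ρ) (hρ' : ρ < 1) {ε : ℝ} (hε : 0 < ε) (d : ℝ) (n : ℕ) :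
    gaussOdds (√(ρ * n) * (-ε - d)) ≤
      ENNReal.ofReal (√(2 * Real.pi) * Real.exp ((1 + 3 * ρ / (1 - ρ)) / 2) *
        Real.exp (-(ρ * (1 - ρ) / 24 * (n * ε ^ 2)))) *
      ENNReal.ofReal (Real.exp ((2 + ρ) / 3 * (n * d ^ 2) / 2)) := by
  have hκ : 0 < 1 - ρ := by linarith
  have hn : (0 : ℝ) ≤ n := n.cast_nonneg
  have hr : √(ρ * n) ^ 2 = ρ * n := Real.sq_sqrt (by positivity)
  have hr0 := Real.sqrt_nonneg (ρ * n)
  have hnε : 0 ≤ n * ε ^ 2 := by positivity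
  have hnd : 0 ≤ n * d ^ 2 := by positivity
  have hη : 0 ≤ 3 * ρ / (1 - ρ) := by positivity
  rw [← ENNReal.ofReal_mul (by positivity), mul_assoc, mul_assoc, ← Real.exp_add]
  -- If the estimate is not too low, the Gaussian lower tail gives the decay in `n ε²`. Otherwise
  -- `d² > ε² / 4`, and the decay is paid for by part of the factor in `n d²`.
  rcases le_or_gt (-(ε / 2)) d with h | h
  · have hw : √(ρ * n) * (-ε - d) ≤ -(√(ρ * n) * (ε / 2)) := by nlinarith
    refine (gaussOdds_le_of_nonpos (hw.trans (by simp; positivity))).trans ?_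
    apply ENNReal.ofReal_le_ofReal
    rw [mul_assoc]
    rw [← Real.exp_add, ← Real.exp_add]
    gcongr 2
    have hsq : ρ * (n * ε ^ 2) / 4 ≤ (√(ρ * n) * (-ε - d)) ^ 2 := by
      have : (√(ρ * n) * (ε / 2)) ^ 2 ≤ (√(ρ * n) * (-ε - d)) ^ 2 := by
        rw [sq_le_sq, abs_of_nonneg (by positivity)]
        exact (le_neg_of_le_neg hw).trans (neg_le_abs _)
      rw [mul_pow, hr] at this
      linarith
    have h1 : ρ * (1 - ρ) / 24 * (n * ε ^ 2) ≤ ρ * (n * ε ^ 2) / 8 := by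
      have : ρ * (1 - ρ) * (n * ε ^ 2) ≤ ρ * 1 * (n * ε ^ 2) := by gcongr; linarith
      nlinarith
    have h2 : 0 ≤ (2 + ρ) / 3 * (n * d ^ 2) / 2 := by positivity
    linarith
  · have hd : d < 0 := by linarith
    have hw : √(ρ * n) * (-ε - d) ≤ √(ρ * n) * (-d) := by gcongr; linarith
    refine (gaussOdds_le_of_nonneg (by nlinarith) hw).trans ?_
    apply ENNReal.ofReal_le_ofReal
    rw [← Real.exp_add]
    gcongr 2
    set v := √(ρ * n) * (-d) with hv
    have hv2 : v ^ 2 = ρ * (n * d ^ 2) := by rw [hv, mul_pow, hr]; ring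
    -- With this weight the coefficient of `n d²` becomes `(1 + 2ρ) / 3`. The target `(2 + ρ) / 3`
    -- leaves a margin of `(1 - ρ) / 3` for the decay term.
    have hyoung : (v + 1) ^ 2 ≤ v ^ 2 + (1 - ρ) / (3 * ρ) * v ^ 2 + (1 + 3 * ρ / (1 - ρ)) := by
      have h1 : 0 ≤ ((1 - ρ) * v - 3 * ρ) ^ 2 / (3 * ρ * (1 - ρ)) := by positivity
      have h2 : ((1 - ρ) * v - 3 * ρ) ^ 2 / (3 * ρ * (1 - ρ)) =
          (1 - ρ) / (3 * ρ) * v ^ 2 - 2 * v + 3 * ρ / (1 - ρ) := by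
        field_simp
        ring
      nlinarith
    have hv3 : (1 - ρ) / (3 * ρ) * v ^ 2 = (1 - ρ) / 3 * (n * d ^ 2) := by
      rw [hv2]; field_simp
    have hdε : n * ε ^ 2 / 4 ≤ n * d ^ 2 := by
      have : ε ^ 2 / 4 ≤ d ^ 2 := by nlinarith
      nlinarith
    have h4 : ρ * (1 - ρ) / 24 * (n * ε ^ 2) ≤ (1 - ρ) / 6 * (n * d ^ 2) := by
      have e1 : ρ * (1 - ρ) / 24 * (n * ε ^ 2) ≤ 1 * (1 - ρ) / 24 * (n * ε ^ 2) := by gcongr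
      have e2 : (1 - ρ) / 6 * (n * ε ^ 2 / 4) ≤ (1 - ρ) / 6 * (n * d ^ 2) := by gcongr
      linarith
    rw [hv3, hv2] at hyoung
    linarith

/-- Expected number of rounds lost because the samples of an arm are too small. -/
lemma exists_sum_lintegral_iSup_gaussOdds_le {ρ : ℝ} (hρ : 0 < ρ) (hρ' : ρ < 1) :
    ∃ C : ℝ, 0 ≤ C ∧ ∀ {Ω : Type u} [MeasurableSpace Ω] (P : Measure Ω) [IsProbabilityMeasure P]
      (Y : ℕ → Ω → ℝ), (∀ i, Measurable (Y i)) → iIndepFun Y P →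
      (∀ i, HasSubgaussianMGF (Y i) 1 P) → ∀ (T : ℕ) {ε : ℝ}, 0 < ε →
      ∑ k ∈ Finset.Icc 1 T, ∫⁻ ω, ⨆ n ∈ Finset.Ioc (k / 2) k,
        gaussOdds (√(ρ * n) * (-ε - partialSum Y n ω / n)) ∂P ≤ ENNReal.ofReal (C / ε ^ 2) := by
  have hκ : 0 < 1 - ρ := by linarith
  -- This is the condition `(2 + ρ) / 3 < J / (J + 1)` solved for `J`.
  obtain ⟨J, hJ⟩ : ∃ J : ℕ, (2 + ρ) / (1 - ρ) < J := exists_nat_gt _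
  have hJ0 : 0 < J := by
    have : (0 : ℝ) < J := lt_trans (by positivity) hJ
    exact_mod_cast this
  have hβ : (2 + ρ) / 3 < J / (J + 1) := by
    rw [div_lt_iff₀ hκ] at hJ
    rw [div_lt_div_iff₀ (by norm_num) (by positivity)]
    linarith
  set A := √(2 * Real.pi) * Real.exp ((1 + 3 * ρ / (1 - ρ)) / 2) with hA
  have hA0 : 0 ≤ A := by positivity
  set c := ρ * (1 - ρ) / 24 with hc
  have hc0 : 0 < c := by positivity
  set Q := (expSupConst ((2 + ρ) / 3) J).toReal with hQ
  have hQ' : expSupConst ((2 + ρ) / 3) J = ENNReal.ofReal Q :=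
    (ENNReal.ofReal_toReal (expSupConst_ne_top hβ)).symm
  refine ⟨A * Q * (2 / c), by positivity, ?_⟩
  intro Ω _ P _ Y hY hind hsub T ε hε
  have hterm : ∀ k ∈ Finset.Icc 1 T, ∫⁻ ω, ⨆ n ∈ Finset.Ioc (k / 2) k,
        gaussOdds (√(ρ * n) * (-ε - partialSum Y n ω / n)) ∂P ≤
      ENNReal.ofReal (A * Q) * ENNReal.ofReal (Real.exp (-(k * (c * ε ^ 2 / 2)))) := by
    intro k hk
    rw [Finset.mem_Icc] at hk
    calc ∫⁻ ω, ⨆ n ∈ Finset.Ioc (k / 2) k,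
          gaussOdds (√(ρ * n) * (-ε - partialSum Y n ω / n)) ∂P
        ≤ ∫⁻ ω, ENNReal.ofReal (A * Real.exp (-(k * (c * ε ^ 2 / 2)))) *
          ⨆ n ∈ Finset.Ioc (k / 2) k,
          ENNReal.ofReal (Real.exp ((2 + ρ) / 3 * (partialSum Y n ω ^ 2 / n) / 2)) ∂P := by
          refine lintegral_mono fun ω => iSup₂_le fun n hn => ?_
          have hkn : (k : ℝ) ≤ 2 * n := by
            rw [Finset.mem_Ioc] at hn
            have : k ≤ 2 * n := by omega
            exact_mod_cast this
          have hn' : (0 : ℝ) < n := by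
            have : (1 : ℝ) ≤ k := by exact_mod_cast hk.1
            linarith
          refine (gaussOdds_sample_le hρ hρ' hε _ n).trans (mul_le_mul' ?_ ?_)
          · apply ENNReal.ofReal_le_ofReal
            gcongr A * Real.exp (-?_)
            have := mul_le_mul_of_nonneg_right hkn (by positivity : 0 ≤ c * ε ^ 2 / 2)
            rw [← hc]
            linarith
          · refine le_iSup₂_of_le n hn (le_of_eq ?_)
            congr 4
            field_simp
      _ ≤ ENNReal.ofReal (A * Real.exp (-(k * (c * ε ^ 2 / 2)))) * ENNReal.ofReal Q := by
          rw [lintegral_const_mul' _ _ ENNReal.ofReal_ne_top, ← hQ']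
          gcongr
          exact lintegral_iSup_exp_le hY hind hsub (by positivity) hJ0 hk.1
      _ = _ := by
          rw [← ENNReal.ofReal_mul (by positivity), ← ENNReal.ofReal_mul (by positivity)]
          congr 1; ring
  refine (Finset.sum_le_sum hterm).trans ?_
  rw [← Finset.mul_sum]
  refine (mul_le_mul_right (sum_Icc_exp_neg_le (by positivity) T) _).trans ?_
  rw [← ENNReal.ofReal_mul (by positivity)]
  apply ENNReal.ofReal_le_ofReal (le_of_eq _)
  field_simp

end Gaussian

/-! ### Measurability of the trajectory. -/

section Measurability

variable {N : ℕ}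

instance : MeasurableSpace (State N) := ⊤

instance : DiscreteMeasurableSpace (State N) := ⟨fun _ => trivial⟩

instance : Countable (State N) :=
  Function.Injective.countable
    (f := fun σ : State N => (σ.pulls, σ.level, σ.seen, σ.batches)) fun σ τ h => by
      cases σ; cases τ; simp_all

/-- The counters take countably many values, so measurability need only be checked with the state
held fixed. -/
lemma measurable_of_countable_param {A B S : Type*} [MeasurableSpace A] [MeasurableSpace B]
    [MeasurableSpace S] [Countable S] [MeasurableSingletonClass S] {g : S → A → B}
    (hg : ∀ s, Measurable (g s)) {f : A → S} (hf : Measurable f) : Measurable fun a => g (f a) a :=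
  (measurable_from_prod_countable_right (f := fun q : S × A => g q.1 q.2) hg).comp
    (hf.prodMk measurable_id)

@[fun_prop]
lemma measurable_empMean (s : ℕ) : Measurable fun x : ℕ → ℝ => empMean x s := by
  unfold empMean; fun_prop

@[fun_prop]
lemma measurable_clipLevel (N T : ℕ) (α : ℝ) (s : ℕ) :
    Measurable fun x : ℕ → ℝ => clipLevel N T α x s := by
  unfold clipLevel; fun_prop

lemma measurable_clippedSample (N T : ℕ) (ρ α : ℝ) (s : ℕ) :
    Measurable fun q : (ℕ → ℝ) × ℝ => clippedSample N T ρ α q.1 s q.2 := by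
  unfold clippedSample; fun_prop

/-- Rewards and noise, the input of the algorithm. -/
abbrev Input (N : ℕ) := (Fin N → ℕ → ℝ) × (ℕ → Fin N → ℝ)

lemma measurable_nextArm {p : Params N} (hp : Measurable p.argmax) (t : ℕ) (σ : State N) :
    Measurable fun q : Input N => nextArm p q.1 q.2 t σ := by
  unfold nextArm
  split_ifs with h
  · exact measurable_const
  · refine hp.comp (measurable_pi_lambda _ fun a => ?_)
    exact (measurable_clippedSample N p.T p.ρ p.α (σ.seen a)).comp
      (Measurable.prodMk (by fun_prop) (by fun_prop) :
        Measurable fun q : Input N => (q.1 a, q.2 t a))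

lemma measurable_state {p : Params N} (hp : Measurable p.argmax) (t : ℕ) :
    Measurable fun q : Input N => state p q.1 q.2 t := by
  induction t with
  | zero => exact measurable_const
  | succ t ih =>
    have harm : Measurable fun q : Input N => nextArm p q.1 q.2 t (state p q.1 q.2 t) :=
      measurable_of_countable_param (g := fun σ (q : Input N) => nextArm p q.1 q.2 t σ)
        (measurable_nextArm hp t) ih
    exact measurable_of_countable_param
      (g := fun σ (q : Input N) => State.play p.refresh σ (nextArm p q.1 q.2 t (state p q.1 q.2 t)))
      (fun σ => (Measurable.of_discrete (f := State.play p.refresh σ)).comp harm) ih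

lemma measurable_arm {p : Params N} (hp : Measurable p.argmax) (t : ℕ) :
    Measurable fun q : Input N => arm p q.1 q.2 t :=
  measurable_of_countable_param (g := fun σ (q : Input N) => nextArm p q.1 q.2 t σ)
    (measurable_nextArm hp t) (measurable_state hp t)

/-- The sample of arm `a` in round `t`. -/
noncomputable def sample (p : Params N) (x : Fin N → ℕ → ℝ) (z : ℕ → Fin N → ℝ) (t : ℕ)
    (a : Fin N) : ℝ :=
  clippedSample N p.T p.ρ p.α (x a) ((state p x z t).seen a) (z t a)

lemma measurable_sample {p : Params N} (hp : Measurable p.argmax) (t : ℕ) (a : Fin N) :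
    Measurable fun q : Input N => sample p q.1 q.2 t a :=
  measurable_of_countable_param
    (g := fun (σ : State N) (q : Input N) =>
      clippedSample N p.T p.ρ p.α (q.1 a) (σ.seen a) (q.2 t a))
    (fun σ => (measurable_clippedSample N p.T p.ρ p.α (σ.seen a)).comp
      (Measurable.prodMk (by fun_prop) (by fun_prop) :
        Measurable fun q : Input N => (q.1 a, q.2 t a))) (measurable_state hp t)

lemma state_congr (p : Params N) (x : Fin N → ℕ → ℝ) {z z' : ℕ → Fin N → ℝ} {t : ℕ}
    (h : ∀ s < t, z s = z' s) : state p x z t = state p x z' t := by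
  induction t with
  | zero => rfl
  | succ t ih =>
    simp only [state]
    rw [ih fun s hs => h s (by omega)]
    simp only [nextArm, h t (by omega)]

lemma state_update (p : Params N) (x : Fin N → ℕ → ℝ) (z : ℕ → Fin N → ℝ) (t : ℕ) (w : Fin N → ℝ) :
    state p x (Function.update z t w) t = state p x z t :=
  state_congr p x fun s hs => by simp [hs.ne]

end Measurability

/-! ### Resampling the noise of a single round. -/

section Resampling

variable {N : ℕ} {Ω : Type*} [MeasurableSpace Ω] {P : Measure Ω}
  {ν : Fin N → Measure ℝ} {X : Fin N → ℕ → Ω → ℝ} {Z : ℕ → Fin N → Ω → ℝ}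

/-- The rewards and the noise of the outcome `ω`. -/
def input (X : Fin N → ℕ → Ω → ℝ) (Z : ℕ → Fin N → Ω → ℝ) (ω : Ω) : Input N :=
  (fun a i => X a i ω, fun t a => Z t a ω)

lemma IsModel.measurable_input (h : IsModel P ν X Z) : Measurable (input X Z) := by
  have h1 := h.measurable_reward
  have h2 := h.measurable_noise
  unfold input
  fun_prop

/-- The noise of a round may be replaced by an independent copy. -/
lemma IsModel.lintegral_resample [IsProbabilityMeasure P] (h : IsModel P ν X Z) (t : ℕ)
    {F : Input N → ℝ≥0∞} (hF : Measurable F) :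
    ∫⁻ ω, F (input X Z ω) ∂P = ∫⁻ ω, ∫⁻ w, F ((input X Z ω).1, Function.update (input X Z ω).2 t w)
      ∂(Measure.pi fun _ : Fin N => gaussianReal 0 1) ∂P := by
  set f : (Fin N × ℕ) ⊕ (ℕ × Fin N) → Ω → ℝ :=
    Sum.elim (fun q : Fin N × ℕ => X q.1 q.2) (fun q : ℕ × Fin N => Z q.1 q.2) with hf
  have hfm : ∀ i, Measurable (f i) := by
    rintro (q | q)
    · exact h.measurable_reward _ _
    · exact h.measurable_noise _ _
  set S : Set ((Fin N × ℕ) ⊕ (ℕ × Fin N)) := Set.range fun a => Sum.inr (t, a) with hS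
  -- Overwriting row `t` by zero makes the remaining input a function of variables independent of
  -- that row.
  set H : Ω → Input N := fun ω => ((input X Z ω).1, Function.update (input X Z ω).2 t 0) with hH
  set W : Ω → Fin N → ℝ := fun ω a => Z t a ω with hW
  have hHS : Measurable[famSigma f Sᶜ] H := by
    refine Measurable.prodMk ?_ ?_
    · refine @measurable_pi_lambda _ _ _ (famSigma f Sᶜ) _ _ fun a =>
        @measurable_pi_lambda _ _ _ (famSigma f Sᶜ) _ _ fun i => ?_
      exact measurable_famSigma f (i := Sum.inl (a, i)) (by simp [hS])
    · refine @measurable_pi_lambda _ _ _ (famSigma f Sᶜ) _ _ fun s =>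
        @measurable_pi_lambda _ _ _ (famSigma f Sᶜ) _ _ fun a => ?_
      rcases eq_or_ne s t with rfl | hs
      · simp only [Function.update_self]
        exact measurable_const
      · simp only [Function.update_of_ne hs]
        exact measurable_famSigma f (i := Sum.inr (s, a)) (by simp [hS, hs.symm])
  have hWS : Measurable[famSigma f S] W := by
    refine @measurable_pi_lambda _ _ _ (famSigma f S) _ _ fun a => ?_
    exact measurable_famSigma f (i := Sum.inr (t, a)) (by simp [hS])
  have hind : IndepFun H W P := by
    rw [IndepFun_iff_Indep]
    exact indep_of_indep_of_le (indep_famSigma hfm h.indep disjoint_compl_left)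
      hHS.comap_le hWS.comap_le
  have hHm : Measurable H := hHS.mono (famSigma_le hfm _) le_rfl
  have hWm : Measurable W := hWS.mono (famSigma_le hfm _) le_rfl
  have hWlaw : P.map W = Measure.pi fun _ : Fin N => gaussianReal 0 1 := by
    have hi : iIndepFun (Z t) P := h.indep.precomp (g := fun a : Fin N => Sum.inr (t, a))
      (fun a b hab => by simpa using hab)
    exact (hi.hasLaw_pi fun a => h.law_noise t a).map_eq
  have hupd : Measurable fun q : Input N × (Fin N → ℝ) => (q.1.1, Function.update q.1.2 t q.2) := by
    refine Measurable.prodMk (by fun_prop) (measurable_pi_lambda _ fun s => ?_)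
    rcases eq_or_ne s t with rfl | hs
    · simp only [Function.update_self]; fun_prop
    · simp only [Function.update_of_ne hs]; fun_prop
  have hG : Measurable fun q : Input N × (Fin N → ℝ) => F (q.1.1, Function.update q.1.2 t q.2) :=
    hF.comp hupd
  have hjoint := (indepFun_iff_map_prod_eq_prod_map_map hHm.aemeasurable hWm.aemeasurable).1 hind
  calc ∫⁻ ω, F (input X Z ω) ∂P
      = ∫⁻ ω, F ((H ω).1, Function.update (H ω).2 t (W ω)) ∂P := by
        refine lintegral_congr fun ω => ?_
        simp only [hH, Function.update_idem]
        have : Function.update (input X Z ω).2 t (W ω) = (input X Z ω).2 :=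
          Function.update_eq_self t _
        rw [this]
    _ = ∫⁻ q, F (q.1.1, Function.update q.1.2 t q.2) ∂(P.map fun ω => (H ω, W ω)) :=
        (lintegral_map hG (hHm.prodMk hWm)).symm
    _ = ∫⁻ q, ∫⁻ w, F (q.1, Function.update q.2 t w) ∂(Measure.pi fun _ : Fin N => gaussianReal 0 1)
          ∂(P.map H) := by
        rw [hjoint, hWlaw, lintegral_prod _ hG.aemeasurable]
    _ = _ := by
        rw [lintegral_map hG.lintegral_prod_right' hHm]
        simp only [hH, Function.update_idem]

end Resampling

/-! ### Comparison of plays of a suboptimal arm with plays of the best arm. -/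

section Rounds

variable {N : ℕ}

lemma monotone_gaussOdds : Monotone gaussOdds := fun _ _ h =>
  ENNReal.div_le_div (measure_mono (Set.Iic_subset_Iic.2 h)) (measure_mono (Set.Ioi_subset_Ioi h))

lemma gaussianReal_Iic_eq (w : ℝ) :
    gaussianReal 0 1 (Set.Iic w) = gaussOdds w * gaussianReal 0 1 (Set.Ioi w) :=
  (ENNReal.div_mul_cancel (gaussianReal_Ioi_pos w) (measure_ne_top _ _)).symm

/-- If the coordinates of a vector are functions of independent standard normal numbers, then the
event that all of them are small is, up to the odds of this for coordinate `s`, less likely than the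
event that coordinate `s` is the largest. -/
lemma pi_gaussian_argmax_le {argmax : (Fin N → ℝ) → Fin N}
    (hmax : ∀ (θ : Fin N → ℝ) (b : Fin N), θ b ≤ θ (argmax θ)) (g : Fin N → ℝ → ℝ) (s i : Fin N)
    {y w₀ : ℝ} (hs : ∀ u, g s u ≤ y ↔ u ≤ w₀) :
    Measure.pi (fun _ : Fin N => gaussianReal 0 1)
        {w | argmax (fun a => g a (w a)) = i ∧ g i (w i) ≤ y} ≤
      gaussOdds w₀ * Measure.pi (fun _ : Fin N => gaussianReal 0 1)
        {w | argmax (fun a => g a (w a)) = s} := by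
  set F : Fin N → Set ℝ := fun b => {u | g b u ≤ y} with hF
  have hFs : F s = Set.Iic w₀ := by ext u; exact hs u
  have h1 : {w : Fin N → ℝ | argmax (fun a => g a (w a)) = i ∧ g i (w i) ≤ y} ⊆
      Set.univ.pi F := by
    rintro w ⟨hw, hi⟩ b -
    have := hmax (fun a => g a (w a)) b
    rw [hw] at this
    exact this.trans hi
  have h2 : Set.univ.pi (Function.update F s (Set.Ioi w₀)) ⊆
      {w : Fin N → ℝ | argmax (fun a => g a (w a)) = s} := by
    intro w hw
    by_contra hne
    have hne : argmax (fun a => g a (w a)) ≠ s := hne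
    have hws := hw s (Set.mem_univ _)
    have hwb := hw (argmax fun a => g a (w a)) (Set.mem_univ _)
    rw [Function.update_self] at hws
    rw [Function.update_of_ne hne] at hwb
    have h3 : y < g s (w s) := not_le.1 fun h => not_lt.2 ((hs _).1 h) hws
    exact not_lt.2 ((hmax (fun a => g a (w a)) s).trans hwb) h3
  -- The two boxes differ only in coordinate `s`, so their measures differ exactly by the odds of
  -- that coordinate.
  refine (measure_mono h1).trans (le_trans (le_of_eq ?_) (mul_le_mul_right (measure_mono h2) _))
  rw [Measure.pi_pi, Measure.pi_pi, ← Finset.mul_prod_erase _ _ (Finset.mem_univ s),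
    ← Finset.mul_prod_erase _ (fun a => gaussianReal 0 1 (Function.update F s (Set.Ioi w₀) a))
      (Finset.mem_univ s), Function.update_self, hFs, gaussianReal_Iic_eq, mul_assoc]
  congr 2
  refine Finset.prod_congr rfl fun b hb => ?_
  rw [Function.update_of_ne (Finset.ne_of_mem_erase hb)]

/-- When the clipping level exceeds `y`, clipping does not affect comparison with `y`, and the odds
are those of the unclipped Gaussian. -/
lemma clippedSample_le_iff {T : ℕ} {ρ α : ℝ} {x : ℕ → ℝ} {n : ℕ} (hρ : 0 < ρ) (hn : 0 < n)
    {y : ℝ} (hy : y < clipLevel N T α x n) (u : ℝ) :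
    clippedSample N T ρ α x n u ≤ y ↔ u ≤ √(ρ * n) * (y - empMean x n) := by
  have hr : 0 < √(ρ * n) := Real.sqrt_pos.2 (mul_pos hρ (by exact_mod_cast hn))
  unfold clippedSample
  rw [min_le_iff, or_iff_left (not_le.2 hy), ← le_sub_iff_add_le', div_le_iff₀' hr]

/-- The rewards `x` for which the clipping level of arm `s` always exceeds `y`. -/
def clipAbove (p : Params N) (s : Fin N) (y : ℝ) : Set (Fin N → ℕ → ℝ) :=
  {x | ∀ n ∈ Finset.Icc 1 p.T, y < clipLevel N p.T p.α (x s) n}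

lemma measurableSet_clipAbove (p : Params N) (s : Fin N) (y : ℝ) :
    MeasurableSet (clipAbove p s y) := by
  have : clipAbove p s y =
      ⋂ n ∈ Finset.Icc 1 p.T, {x | y < clipLevel N p.T p.α (x s) n} := by
    ext; simp [clipAbove]
  rw [this]
  exact Finset.measurableSet_biInter _ fun n _ => measurableSet_lt measurable_const (by fun_prop)

/-- The odds that the sample of an arm with rewards `x`, based on `n` of them, is at most `y`. -/
noncomputable def sampleOdds (ρ y : ℝ) (x : ℕ → ℝ) (n : ℕ) : ℝ≥0∞ :=
  gaussOdds (√(ρ * n) * (y - empMean x n))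

lemma measurable_sampleOdds (ρ y : ℝ) (n : ℕ) : Measurable fun x => sampleOdds ρ y x n := by
  have := monotone_gaussOdds.measurable
  unfold sampleOdds
  fun_prop

variable {Ω : Type*} [MeasurableSpace Ω] {P : Measure Ω} [IsProbabilityMeasure P]
  {ν : Fin N → Measure ℝ} {X : Fin N → ℕ → Ω → ℝ} {Z : ℕ → Fin N → Ω → ℝ}

open Classical in
/-- In every round, the probability that arm `i` is played with a sample at most `y` is controlled
by the probability that arm `s` is played. -/
lemma IsModel.lintegral_round_le (h : IsModel P ν X Z) {p : Params N} (hp : Measurable p.argmax)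
    (hmax : ∀ (θ : Fin N → ℝ) (b : Fin N), θ b ≤ θ (p.argmax θ)) (hρ : 0 < p.ρ) {t : ℕ}
    (hNt : N ≤ t) (htT : t < p.T) (s i : Fin N) (y : ℝ) :
    ∫⁻ ω, (if (input X Z ω).1 ∈ clipAbove p s y ∧ arm p (input X Z ω).1 (input X Z ω).2 t = i ∧
        sample p (input X Z ω).1 (input X Z ω).2 t i ≤ y then 1 else 0) ∂P ≤
      ∫⁻ ω, (if arm p (input X Z ω).1 (input X Z ω).2 t = s then
        sampleOdds p.ρ y ((input X Z ω).1 s)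
          ((state p (input X Z ω).1 (input X Z ω).2 t).seen s) else 0) ∂P := by
  have hstate := measurable_state hp t
  have harm := measurable_arm hp t
  have hsample := measurable_sample hp t i
  have hF₁ : Measurable fun q : Input N => if q.1 ∈ clipAbove p s y ∧ arm p q.1 q.2 t = i ∧
        sample p q.1 q.2 t i ≤ y then (1 : ℝ≥0∞) else 0 := by
    refine Measurable.ite ?_ measurable_const measurable_const
    exact ((measurableSet_clipAbove p s y).preimage measurable_fst).inter
      ((harm (measurableSet_singleton i)).inter (measurableSet_le hsample measurable_const))
  have hF₂ : Measurable fun q : Input N => if arm p q.1 q.2 t = s then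
        sampleOdds p.ρ y (q.1 s) ((state p q.1 q.2 t).seen s) else 0 := by
    refine Measurable.ite (harm (measurableSet_singleton s)) ?_ measurable_const
    exact measurable_of_countable_param
      (g := fun (σ : State N) (q : Input N) => sampleOdds p.ρ y (q.1 s) (σ.seen s))
      (fun σ => (measurable_sampleOdds p.ρ y (σ.seen s)).comp (by fun_prop)) hstate
  rw [h.lintegral_resample t hF₁, h.lintegral_resample t hF₂]
  refine lintegral_mono fun ω => ?_
  generalize (input X Z ω).1 = x
  generalize (input X Z ω).2 = z
  -- The counters before round `t` do not see the noise of round `t`, so they stay fixed while it is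
  -- integrated out.
  have harm' : ∀ w, arm p x (Function.update z t w) t = p.argmax fun a =>
      clippedSample N p.T p.ρ p.α (x a) ((state p x z t).seen a) (w a) := fun w => by
    simp [arm, nextArm, not_lt.2 hNt, state_update]
  simp only [harm', sample, state_update, Function.update_self]
  by_cases hx : x ∈ clipAbove p s y
  · have hn := seen_pos p x z hNt s
    have hn' : (state p x z t).seen s ≤ p.T :=
      ((state_inv p x z t).seen_le s).trans ((pulls_le p x z t s).trans htT.le)
    have hclip := hx _ (Finset.mem_Icc.2 ⟨hn, hn'⟩)
    have key := pi_gaussian_argmax_le hmax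
      (fun a u => clippedSample N p.T p.ρ p.α (x a) ((state p x z t).seen a) u) s i
      (clippedSample_le_iff hρ hn hclip)
    have hm : Measurable fun w : Fin N → ℝ => p.argmax fun a =>
        clippedSample N p.T p.ρ p.α (x a) ((state p x z t).seen a) (w a) :=
      hp.comp (measurable_pi_lambda _ fun a =>
        (measurable_clippedSample N p.T p.ρ p.α _).comp
          (measurable_const.prodMk (measurable_pi_apply a)))
    simp only [hx, true_and]
    refine le_trans ?_ (key.trans ?_)
    · refine (lintegral_indicator_const_le _ 1).trans' (le_of_eq ?_) |>.trans (by rw [one_mul])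
      refine lintegral_congr fun w => ?_
      simp [Set.indicator_apply]
    · have hms : MeasurableSet {w : Fin N → ℝ | (p.argmax fun a =>
          clippedSample N p.T p.ρ p.α (x a) ((state p x z t).seen a) (w a)) = s} :=
        hm (measurableSet_singleton s)
      rw [← lintegral_indicator_const hms]
      refine lintegral_mono fun w => ?_
      simp [Set.indicator_apply, sampleOdds]
  · simp [hx]

open Classical in
/-- Bound for the expected number of rounds in which arm `i` is played and the clipping level of
arm `s` is not an obstacle. -/
lemma IsModel.lintegral_count_le (h : IsModel P ν X Z) {p : Params N} (hp : Measurable p.argmax)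
    (hmax : ∀ (θ : Fin N → ℝ) (b : Fin N), θ b ≤ θ (p.argmax θ)) (hρ : 0 < p.ρ)
    (s i : Fin N) (y : ℝ) :
    ∫⁻ ω, ∑ t ∈ Finset.Ico N p.T, (if (input X Z ω).1 ∈ clipAbove p s y ∧
        arm p (input X Z ω).1 (input X Z ω).2 t = i then 1 else 0) ∂P ≤
      ∑ k ∈ Finset.Icc 1 p.T, ∫⁻ ω, ⨆ n ∈ Finset.Ioc (k / 2) k,
        sampleOdds p.ρ y (fun j => X s j ω) n ∂P +
      ∑ k ∈ Finset.Icc 1 p.T, P {ω | ∃ n ∈ Finset.Ioc (k / 2) k,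
        y < clipLevel N p.T p.α (fun j => X i j ω) n} := by
  have hin := h.measurable_input
  have hXm : ∀ a, Measurable fun ω j => X a j ω := fun a =>
    measurable_pi_lambda _ fun j => h.measurable_reward a j
  have hclipm : ∀ n, MeasurableSet {ω | y < clipLevel N p.T p.α (fun j => X i j ω) n} := fun n =>
    measurableSet_lt measurable_const ((measurable_clipLevel N p.T p.α n).comp (hXm i))
  have hsetm : ∀ t, MeasurableSet {ω | (input X Z ω).1 ∈ clipAbove p s y ∧
      arm p (input X Z ω).1 (input X Z ω).2 t = i ∧
      sample p (input X Z ω).1 (input X Z ω).2 t i ≤ y} := fun t =>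
    (((measurableSet_clipAbove p s y).preimage measurable_fst).inter
      (((measurable_arm hp t) (measurableSet_singleton i)).inter
        (measurableSet_le (measurable_sample hp t i) measurable_const))).preimage hin
  have hoddsm : ∀ t, Measurable fun ω => if arm p (input X Z ω).1 (input X Z ω).2 t = s then
        sampleOdds p.ρ y ((input X Z ω).1 s)
          ((state p (input X Z ω).1 (input X Z ω).2 t).seen s) else 0 := fun t => by
    refine Measurable.ite (((measurable_arm hp t) (measurableSet_singleton s)).preimage hin) ?_
      measurable_const
    exact (measurable_of_countable_param
      (g := fun (σ : State N) (q : Input N) => sampleOdds p.ρ y (q.1 s) (σ.seen s))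
      (fun σ => (measurable_sampleOdds p.ρ y (σ.seen s)).comp (by fun_prop))
      (measurable_state hp t)).comp hin
  have hsplit : ∀ ω, ∑ t ∈ Finset.Ico N p.T, (if (input X Z ω).1 ∈ clipAbove p s y ∧
        arm p (input X Z ω).1 (input X Z ω).2 t = i then (1 : ℝ≥0∞) else 0) ≤
      ∑ t ∈ Finset.Ico N p.T, (if (input X Z ω).1 ∈ clipAbove p s y ∧
        arm p (input X Z ω).1 (input X Z ω).2 t = i ∧
        sample p (input X Z ω).1 (input X Z ω).2 t i ≤ y then 1 else 0) +
      ∑ k ∈ Finset.Icc 1 p.T, {ω | ∃ n ∈ Finset.Ioc (k / 2) k,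
        y < clipLevel N p.T p.α (fun j => X i j ω) n}.indicator 1 ω := fun ω => by
    have h1 := sum_arm_le_sum_iSup p (input X Z ω).1 (input X Z ω).2 p.T i
      fun n => if y < clipLevel N p.T p.α (fun j => X i j ω) n then 1 else 0
    have h2 : ∀ k ∈ Finset.Icc 1 p.T, ⨆ n ∈ Finset.Ioc (k / 2) k,
        (if y < clipLevel N p.T p.α (fun j => X i j ω) n then (1 : ℝ≥0∞) else 0) ≤
        {ω | ∃ n ∈ Finset.Ioc (k / 2) k,
          y < clipLevel N p.T p.α (fun j => X i j ω) n}.indicator 1 ω := fun k _ => by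
      refine iSup₂_le fun n hn => ?_
      split_ifs with hy
      · rw [Set.indicator_of_mem (by exact ⟨n, hn, hy⟩)]
        exact le_rfl
      · exact zero_le
    refine le_trans ?_ (add_le_add le_rfl (h1.trans (Finset.sum_le_sum h2)))
    rw [← Finset.sum_add_distrib]
    refine Finset.sum_le_sum fun t _ => ?_
    by_cases ha : arm p (input X Z ω).1 (input X Z ω).2 t = i
    · by_cases hle : sample p (input X Z ω).1 (input X Z ω).2 t i ≤ y
      · simp only [ha, hle, and_true]
        exact le_self_add
      · have : y < clipLevel N p.T p.α (fun j => X i j ω)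
            ((state p (input X Z ω).1 (input X Z ω).2 t).seen i) :=
          (not_le.1 hle).trans_le (min_le_right _ _)
        simp only [ha, if_true, this]
        refine le_trans ?_ le_add_self
        split_ifs <;> simp
    · simp [ha]
  refine (lintegral_mono hsplit).trans ?_
  rw [lintegral_add_left (Finset.measurable_fun_sum _ fun t _ =>
    Measurable.ite (hsetm t) measurable_const measurable_const)]
  refine add_le_add ?_ ?_
  · rw [lintegral_finsetSum _ fun t _ =>
      Measurable.ite (hsetm t) measurable_const measurable_const]
    have hle : ∀ t ∈ Finset.Ico N p.T, _ := fun t ht =>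
      h.lintegral_round_le hp hmax hρ (Finset.mem_Ico.1 ht).1 (Finset.mem_Ico.1 ht).2 s i y
    refine (Finset.sum_le_sum hle).trans ?_
    rw [← lintegral_finsetSum _ fun t _ => hoddsm t]
    refine (lintegral_mono fun ω => sum_arm_le_sum_iSup p (input X Z ω).1 (input X Z ω).2 p.T s
      (sampleOdds p.ρ y ((input X Z ω).1 s))).trans ?_
    rw [lintegral_finsetSum]
    · exact le_rfl
    · intro k _
      refine Measurable.iSup fun n => Measurable.iSup fun _ => ?_
      exact (measurable_sampleOdds p.ρ y n).comp (hXm s)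
  · rw [lintegral_finsetSum']
    · refine Finset.sum_le_sum fun k _ => lintegral_indicator_one_le _
    · intro k _
      refine (measurable_one.indicator ?_).aemeasurable
      have : {ω | ∃ n ∈ Finset.Ioc (k / 2) k, y < clipLevel N p.T p.α (fun j => X i j ω) n} =
          ⋃ n ∈ Finset.Ioc (k / 2) k, {ω | y < clipLevel N p.T p.α (fun j => X i j ω) n} := by
        ext; simp
      rw [this]
      exact Finset.measurableSet_biUnion _ fun n _ => hclipm n

end Rounds

/-! ### Decomposition of the regret. -/

section Regret

variable {N : ℕ} {ν : Fin N → Measure ℝ}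

lemma gap_nonneg (ν : Fin N → Measure ℝ) (a : Fin N) : 0 ≤ gap ν a :=
  sub_nonneg.2 (le_ciSup (Set.finite_range _).bddAbove a)

lemma exists_best_arm (hN : 0 < N) (ν : Fin N → Measure ℝ) :
    ∃ s, ∀ a, gap ν a = mean ν s - mean ν a := by
  have : Nonempty (Fin N) := ⟨⟨0, hN⟩⟩
  obtain ⟨s, hs⟩ := exists_eq_ciSup_of_finite (f := mean ν)
  exact ⟨s, fun a => by rw [gap, ← hs]⟩

variable {Ω : Type*}

/-- The rewards of an arm, centred. -/
noncomputable def centred (ν : Fin N → Measure ℝ) (X : Fin N → ℕ → Ω → ℝ) (a : Fin N) (i : ℕ)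
    (ω : Ω) : ℝ := X a i ω - mean ν a

lemma empMean_eq (ν : Fin N → Measure ℝ) (X : Fin N → ℕ → Ω → ℝ) (a : Fin N) {n : ℕ} (hn : 0 < n)
    (ω : Ω) : empMean (fun j => X a j ω) n = mean ν a + partialSum (centred ν X a) n ω / n := by
  have : (n : ℝ) ≠ 0 := by exact_mod_cast hn.ne'
  simp only [empMean, partialSum, centred, Finset.sum_sub_distrib, Finset.sum_const,
    Finset.card_range, nsmul_eq_mul]
  field_simp
  ring

variable [MeasurableSpace Ω] {P : Measure Ω} {X : Fin N → ℕ → Ω → ℝ} {Z : ℕ → Fin N → Ω → ℝ}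

lemma IsModel.measurable_centred (h : IsModel P ν X Z) (a : Fin N) (i : ℕ) :
    Measurable (centred ν X a i) := (h.measurable_reward a i).sub_const _

lemma IsModel.iIndepFun_centred (h : IsModel P ν X Z) (a : Fin N) :
    iIndepFun (centred ν X a) P := by
  have h1 : iIndepFun (X a) P := h.indep.precomp (g := fun i : ℕ => Sum.inl (a, i))
    (fun i j hij => by simpa using hij)
  exact h1.comp (fun _ y => y - mean ν a) (fun _ => measurable_id.sub_const _)

lemma IsModel.hasSubgaussianMGF_centred (h : IsModel P ν X Z) (a : Fin N) (i : ℕ) :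
    HasSubgaussianMGF (centred ν X a i) 1 P := by
  have h1 := h.subgaussian a
  rw [← (h.law_reward a i).map_eq] at h1
  exact HasSubgaussianMGF.of_map (h.measurable_reward a i).aemeasurable h1

lemma measurable_regret (p : Params N) (hp : Measurable p.argmax) (ν : Fin N → Measure ℝ)
    (h : IsModel P ν X Z) :
    Measurable fun ω => regret p ν (fun a i => X a i ω) (fun t a => Z t a ω) := by
  have hg : Measurable (gap ν) := Measurable.of_discrete
  have harm : ∀ t, Measurable fun ω => arm p (fun a i => X a i ω) (fun t a => Z t a ω) t :=
    fun t => by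
      simpa only [input, Function.comp_def] using (measurable_arm hp t).comp h.measurable_input
  unfold regret
  exact Finset.measurable_fun_sum _ fun t _ => hg.comp (harm t)

lemma regret_nonneg (p : Params N) (ν : Fin N → Measure ℝ) (x : Fin N → ℕ → ℝ)
    (z : ℕ → Fin N → ℝ) : 0 ≤ regret p ν x z := Finset.sum_nonneg fun _ _ => gap_nonneg _ _

lemma regret_le (p : Params N) (ν : Fin N → Measure ℝ) {c : ℝ} (hc : ∀ a, gap ν a ≤ c)
    (x : Fin N → ℕ → ℝ) (z : ℕ → Fin N → ℝ) : regret p ν x z ≤ p.T * c := by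
  refine (Finset.sum_le_card_nsmul _ _ c fun t _ => hc _).trans ?_
  simp

lemma integrable_regret [IsProbabilityMeasure P] (p : Params N) (hp : Measurable p.argmax)
    (ν : Fin N → Measure ℝ) (h : IsModel P ν X Z) :
    Integrable (fun ω => regret p ν (fun a i => X a i ω) (fun t a => Z t a ω)) P := by
  refine Integrable.of_bound (measurable_regret p hp ν h).aestronglyMeasurable
    (p.T * ∑ a, gap ν a) (ae_of_all _ fun ω => ?_)
  rw [Real.norm_of_nonneg (regret_nonneg _ _ _ _)]
  exact regret_le p ν (fun a => Finset.single_le_sum (fun b _ => gap_nonneg ν b)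
    (Finset.mem_univ a)) _ _

/-- The event that the clipping level of arm `s` falls by `δ` below its mean. -/
def clipFails (p : Params N) (ν : Fin N → Measure ℝ) (s : Fin N) (δ : ℝ) :
    Set (Fin N → ℕ → ℝ) :=
  {x | ∃ n ∈ Finset.Icc 1 p.T, clipLevel N p.T p.α (x s) n ≤ mean ν s - δ}

lemma clipFails_eq_compl (p : Params N) (ν : Fin N → Measure ℝ) (s : Fin N) (δ : ℝ) :
    clipFails p ν s δ = (clipAbove p s (mean ν s - δ))ᶜ := by
  ext; simp [clipFails, clipAbove, and_assoc]

open Classical in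
/-- Contribution of one round to the regret. -/
lemma gap_arm_le (p : Params N) (ν : Fin N → Measure ℝ) (s : Fin N)
    {δ : ℝ} (hδ : 0 < δ) (x : Fin N → ℕ → ℝ) (b : Fin N) :
    ENNReal.ofReal (gap ν b) ≤ ENNReal.ofReal (2 * δ) +
      ∑' j : ℕ, (if x ∈ clipFails p ν s (2 ^ j * δ) then ENNReal.ofReal (2 ^ (j + 2) * δ) else 0) +
      ∑ a ∈ Finset.univ.filter (fun a => 2 * δ ≤ gap ν a), ENNReal.ofReal (gap ν a) *
        (if x ∈ clipAbove p s (mean ν s - gap ν a / 2) ∧ b = a then 1 else 0) := by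
  rcases lt_or_ge (gap ν b) (2 * δ) with h | h
  · rw [add_assoc]
    exact (ENNReal.ofReal_le_ofReal h.le).trans le_self_add
  by_cases hx : x ∈ clipAbove p s (mean ν s - gap ν b / 2)
  · refine le_trans ?_ le_add_self
    refine le_trans ?_ (Finset.single_le_sum (f := fun a => ENNReal.ofReal (gap ν a) *
        (if x ∈ clipAbove p s (mean ν s - gap ν a / 2) ∧ b = a then 1 else 0)) (fun _ _ => zero_le)
        (Finset.mem_filter.2 ⟨Finset.mem_univ b, h⟩))
    simp [hx]
  · refine le_trans ?_ (le_self_add : _ ≤ _ + _)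
    refine le_trans ?_ (le_add_self : _ ≤ _ + _)
    have hr : 1 ≤ gap ν b / (2 * δ) := by rwa [le_div_iff₀ (by positivity), one_mul]
    -- With `2^j ≤ gap / (2δ) < 2^(j+1)`, a shortfall of half the gap is at least `2^j δ`, while the
    -- gap is below `2^(j+2) δ`.
    obtain ⟨j, hj, hj'⟩ := exists_nat_pow_near hr (one_lt_two : (1 : ℝ) < 2)
    rw [le_div_iff₀ (by positivity)] at hj
    rw [div_lt_iff₀ (by positivity)] at hj'
    refine le_trans ?_ (ENNReal.le_tsum j)
    have hmem : x ∈ clipFails p ν s (2 ^ j * δ) := by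
      rw [← Set.mem_compl_iff, ← clipFails_eq_compl] at hx
      obtain ⟨n, hn, hle⟩ := hx
      exact ⟨n, hn, hle.trans (by linarith)⟩
    rw [if_pos hmem]
    apply ENNReal.ofReal_le_ofReal
    have : (2 : ℝ) ^ (j + 2) * δ = 2 ^ (j + 1) * (2 * δ) := by ring
    rw [this]
    exact hj'.le

lemma IsModel.measure_clipFails_le [IsProbabilityMeasure P] (h : IsModel P ν X Z) (p : Params N)
    (hα : 4 ≤ p.α) (hN : 0 < N) (hT : 0 < p.T) (s : Fin N) {δ : ℝ} (hδ : 0 < δ) :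
    P {ω | (input X Z ω).1 ∈ clipFails p ν s δ} ≤ ENNReal.ofReal (24 * N / (p.T * δ ^ 2)) := by
  refine (measure_mono ?_).trans (measure_exists_clip_le (h.measurable_centred s)
    (h.iIndepFun_centred s) (h.hasSubgaussianMGF_centred s) hα hN hT hδ)
  rintro ω ⟨n, hn, hle⟩
  refine ⟨n, hn, ?_⟩
  have := empMean_eq ν X s (Finset.mem_Icc.1 hn).1 ω
  simp only [clipLevel, input] at hle
  rw [this] at hle
  linarith

open Classical in
/-- Expected number of plays of an arm with a large gap while the clipping level of the best arm is
not an obstacle. -/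
lemma exists_lintegral_count_le {ρ : ℝ} (hρ : 0 < ρ) (hρ' : ρ < 1) :
    ∃ C : ℝ, 0 ≤ C ∧ ∀ (N : ℕ) (p : Params N), 0 < N → p.ρ = ρ → 0 ≤ p.α → Measurable p.argmax →
      (∀ (θ : Fin N → ℝ) (b : Fin N), θ b ≤ θ (p.argmax θ)) →
      ∀ {Ω : Type u} [MeasurableSpace Ω] (P : Measure Ω) [IsProbabilityMeasure P]
        (ν : Fin N → Measure ℝ) (X : Fin N → ℕ → Ω → ℝ) (Z : ℕ → Fin N → Ω → ℝ), IsModel P ν X Z →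
        ∀ (s i : Fin N) (δ : ℝ), 0 < δ → mean ν s - mean ν i = 2 * δ →
        ∫⁻ ω, ∑ t ∈ Finset.Ico N p.T, (if (input X Z ω).1 ∈ clipAbove p s (mean ν s - δ) ∧
          arm p (input X Z ω).1 (input X Z ω).2 t = i then 1 else 0) ∂P ≤
        ENNReal.ofReal ((C + 8 * p.α * Real.posLog (p.T * δ ^ 2 / N) + 34) / δ ^ 2) := by
  obtain ⟨C, hC, hodds⟩ := exists_sum_lintegral_iSup_gaussOdds_le.{u} hρ hρ'
  refine ⟨C, hC, ?_⟩
  intro N p hN hpρ hα hp hmax Ω _ P _ ν X Z h s i δ hδ hgap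
  -- The threshold is the midpoint of the two means: `δ` below that of `s` and `δ` above that of
  -- `i`.
  have h1 := h.lintegral_count_le hp hmax (by rwa [hpρ]) s i (mean ν s - δ)
  have h2 := hodds P (centred ν X s) (h.measurable_centred s) (h.iIndepFun_centred s)
    (h.hasSubgaussianMGF_centred s) p.T hδ
  have h3 := sum_measure_exists_clip_gt_le (h.measurable_centred i) (h.iIndepFun_centred i)
    (h.hasSubgaussianMGF_centred i) hα (T := p.T) hN hδ
  have hL : 0 ≤ Real.posLog (p.T * δ ^ 2 / N) := Real.posLog_nonneg
  have hrw : (C + 8 * p.α * Real.posLog (p.T * δ ^ 2 / N) + 34) / δ ^ 2 =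
      C / δ ^ 2 + (8 * p.α * Real.posLog (p.T * δ ^ 2 / N) + 34) / δ ^ 2 := by
    rw [← add_div, add_assoc]
  rw [hrw, ENNReal.ofReal_add (by positivity) (by positivity)]
  refine h1.trans (add_le_add (le_trans (Finset.sum_le_sum fun k _ => ?_) h2)
    (le_trans (Finset.sum_le_sum fun k _ => ?_) h3))
  · refine lintegral_mono fun ω => iSup₂_mono fun n hn => le_of_eq ?_
    have hn0 : 0 < n := by rw [Finset.mem_Ioc] at hn; omega
    rw [sampleOdds, empMean_eq ν X s hn0, hpρ]
    congr 2
    ring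
  · refine measure_mono ?_
    rintro ω ⟨n, hn, hlt⟩
    refine ⟨n, hn, ?_⟩
    have hn0 : 0 < n := by rw [Finset.mem_Ioc] at hn; omega
    rw [clipLevel, empMean_eq ν X i hn0] at hlt
    linarith

end Regret

/-! ### Summation of the contributions at the scale `√(N/T)`. -/

section MainBound

lemma posLog_le_self {x : ℝ} (hx : 0 ≤ x) : Real.posLog x ≤ x := max_le hx (Real.log_le_self hx)

/-- Here `d² = N/T`, so the logarithm is `log⁺ ((δ/d)²) ≤ 2δ/d`. This linear bound cancels the
remaining `1/δ` and makes the contribution uniform in the gap, without an extra logarithm. -/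
lemma large_gap_contribution_le {C α R d T N δ : ℝ} (hC : 0 ≤ C) (hα : 0 ≤ α) (hT : 0 < T)
    (hN : 0 < N) (hR : 0 < R) (hR2 : R ^ 2 = N * T) (hd : d = R / T) (hδ : d ≤ δ) :
    2 * δ * ((C + 8 * α * Real.posLog (T * δ ^ 2 / N) + 34) / δ ^ 2) ≤
      (2 * (C + 34) + 32 * α) * (R / N) := by
  have hd0 : 0 < d := by rw [hd]; positivity
  have hδ0 : 0 < δ := hd0.trans_le hδ
  have hdN : 1 / d = R / N := by
    rw [hd, one_div_div, div_eq_div_iff hR.ne' hN.ne']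
    linarith
  have hlog : Real.posLog (T * δ ^ 2 / N) ≤ 2 * (δ / d) := by
    have he : T * δ ^ 2 / N = (δ / d) ^ 2 := by
      rw [hd]
      field_simp
      rw [hR2]
      ring
    rw [he, Real.posLog_pow]
    push_cast
    gcongr
    exact posLog_le_self (by positivity)
  have h1 : 1 / δ ≤ 1 / d := by gcongr
  calc 2 * δ * ((C + 8 * α * Real.posLog (T * δ ^ 2 / N) + 34) / δ ^ 2)
      ≤ 2 * δ * ((C + 8 * α * (2 * (δ / d)) + 34) / δ ^ 2) := by gcongr
    _ = 2 * (C + 34) * (1 / δ) + 32 * α * (1 / d) := by field_simp; ring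
    _ ≤ 2 * (C + 34) * (1 / d) + 32 * α * (1 / d) := by gcongr
    _ = _ := by rw [hdN]; ring

lemma sum_range_gap_le {N : ℕ} (p : Params N) (ν : Fin N → Measure ℝ) (x : Fin N → ℕ → ℝ)
    (z : ℕ → Fin N → ℝ) :
    ENNReal.ofReal (regret p ν x z) ≤ ∑ a, ENNReal.ofReal (gap ν a) +
      ∑ t ∈ Finset.Ico N p.T, ENNReal.ofReal (gap ν (arm p x z t)) := by
  rw [regret, ENNReal.ofReal_sum_of_nonneg fun _ _ => gap_nonneg _ _,
    ← Finset.sum_filter_add_sum_filter_not (Finset.range p.T) (fun t => t < N)]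
  have h : ∑ a, ENNReal.ofReal (gap ν a) =
      ∑ t ∈ Finset.range N, ENNReal.ofReal (gap ν (arm p x z t)) := by
    rw [Finset.sum_range]
    exact Finset.sum_congr rfl fun a _ => by rw [arm_of_lt p x z a.2]
  rw [h]
  refine add_le_add (Finset.sum_le_sum_of_subset fun t ht => ?_)
    (Finset.sum_le_sum_of_subset fun t ht => ?_)
  · simp only [Finset.mem_filter, Finset.mem_range] at ht ⊢
    exact ht.2
  · simp only [Finset.mem_filter, Finset.mem_range, Finset.mem_Ico] at ht ⊢
    omega

/-- The cost doubles with `j` while the probability drops by a factor four, so the series is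
geometric with ratio `1/2`. -/
lemma tsum_clipFails_le {R d T N : ℝ} (hT : 0 < T) (hR : 0 < R) (hR2 : R ^ 2 = N * T)
    (hd : d = R / T) :
    ∑' j : ℕ, ENNReal.ofReal (2 ^ (j + 2) * d) * ENNReal.ofReal (24 * N / (T * (2 ^ j * d) ^ 2)) ≤
      ENNReal.ofReal (192 * d) := by
  have hd0 : 0 < d := by rw [hd]; positivity
  have hNd : N = T * d ^ 2 := by
    rw [hd]; field_simp; linarith
  have hterm : ∀ j : ℕ, ENNReal.ofReal (2 ^ (j + 2) * d) *
      ENNReal.ofReal (24 * N / (T * (2 ^ j * d) ^ 2)) = ENNReal.ofReal (96 * d * (1 / 2) ^ j) :=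
    fun j => by
    rw [← ENNReal.ofReal_mul (by positivity), hNd]
    congr 1
    rw [pow_add, one_div, inv_pow]
    field_simp
    norm_num
  simp_rw [hterm]
  rw [← ENNReal.ofReal_tsum_of_nonneg (fun j => by positivity) (summable_geometric_two.mul_left _),
    tsum_mul_left, tsum_geometric_two]
  apply ENNReal.ofReal_le_ofReal
  linarith

open Classical in
/-- The minimax bound for the expected regret. -/
lemma exists_lintegral_regret_le {ρ α : ℝ} (hρ : 0 < ρ) (hρ' : ρ < 1) (hα : 4 ≤ α) :
    ∃ C : ℝ, 1 ≤ C ∧ ∀ (N : ℕ) (p : Params N), 0 < N → 0 < p.T → p.ρ = ρ → p.α = α →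
      Measurable p.argmax → (∀ (θ : Fin N → ℝ) (b : Fin N), θ b ≤ θ (p.argmax θ)) →
      ∀ {Ω : Type u} [MeasurableSpace Ω] (P : Measure Ω) [IsProbabilityMeasure P]
        (ν : Fin N → Measure ℝ) (X : Fin N → ℕ → Ω → ℝ) (Z : ℕ → Fin N → Ω → ℝ), IsModel P ν X Z →
        ∫⁻ ω, ENNReal.ofReal (regret p ν (input X Z ω).1 (input X Z ω).2) ∂P ≤
          ENNReal.ofReal (C * (√((N : ℝ) * p.T) + ∑ a, gap ν a)) := by
  obtain ⟨C, hC, hcount⟩ := exists_lintegral_count_le.{u} hρ hρ'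
  refine ⟨194 + (2 * (C + 34) + 32 * α), by linarith, ?_⟩
  intro N p hN hT hpρ hpα hp hmax Ω _ P _ ν X Z h
  obtain ⟨s, hs⟩ := exists_best_arm hN ν
  have hN' : (0 : ℝ) < N := by exact_mod_cast hN
  have hT' : (0 : ℝ) < p.T := by exact_mod_cast hT
  set R := √((N : ℝ) * p.T) with hR
  have hR0 : 0 < R := Real.sqrt_pos.2 (by positivity)
  have hR2 : R ^ 2 = N * p.T := Real.sq_sqrt (by positivity)
  set d := R / p.T with hd
  have hd0 : 0 < d := by positivity
  have hin := h.measurable_input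
  set A := 2 * (C + 34) + 32 * α with hA
  have hA0 : 0 ≤ A := by positivity
  have hG0 : 0 ≤ ∑ a, gap ν a := Finset.sum_nonneg fun a _ => gap_nonneg ν a
  set B : Ω → ℝ≥0∞ := fun ω => ∑' j : ℕ,
    (if (input X Z ω).1 ∈ clipFails p ν s (2 ^ j * d) then ENNReal.ofReal (2 ^ (j + 2) * d) else 0)
    with hB
  set big := Finset.univ.filter (fun a => 2 * d ≤ gap ν a) with hbig
  set cnt : Fin N → Ω → ℝ≥0∞ := fun a ω => ∑ t ∈ Finset.Ico N p.T,
    (if (input X Z ω).1 ∈ clipAbove p s (mean ν s - gap ν a / 2) ∧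
      arm p (input X Z ω).1 (input X Z ω).2 t = a then 1 else 0) with hcnt
  have hfm : ∀ δ, MeasurableSet {ω | (input X Z ω).1 ∈ clipFails p ν s δ} := fun δ => by
    rw [clipFails_eq_compl]
    exact ((measurableSet_clipAbove p s _).compl.preimage measurable_fst).preimage hin
  have hBm : Measurable B := Measurable.tsum fun j =>
    Measurable.ite (hfm _) measurable_const measurable_const
  have hcm : ∀ a, Measurable (cnt a) := fun a => Finset.measurable_fun_sum _ fun t _ =>
    Measurable.ite ((((measurableSet_clipAbove p s _).preimage measurable_fst).inter
      ((measurable_arm hp t) (measurableSet_singleton a))).preimage hin)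
      measurable_const measurable_const
  have hpath : ∀ ω, ENNReal.ofReal (regret p ν (input X Z ω).1 (input X Z ω).2) ≤
      ∑ a, ENNReal.ofReal (gap ν a) + (p.T * (ENNReal.ofReal (2 * d) + B ω) +
        ∑ a ∈ big, ENNReal.ofReal (gap ν a) * cnt a ω) := fun ω => by
    refine (sum_range_gap_le p ν _ _).trans (add_le_add le_rfl ?_)
    refine (Finset.sum_le_sum fun t _ => gap_arm_le p ν s hd0 (input X Z ω).1 _).trans ?_
    rw [Finset.sum_add_distrib, Finset.sum_comm]
    refine add_le_add ?_ (le_of_eq ?_)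
    · rw [Finset.sum_const, nsmul_eq_mul]
      gcongr
      simp
    · exact Finset.sum_congr rfl fun a _ => by rw [hcnt, ← Finset.mul_sum]
  have hBint : ∫⁻ ω, B ω ∂P ≤ ENNReal.ofReal (192 * d) := by
    rw [hB, lintegral_tsum fun j =>
      (Measurable.ite (hfm _) measurable_const measurable_const).aemeasurable]
    refine le_trans (ENNReal.tsum_le_tsum fun j => ?_) (tsum_clipFails_le hT' hR0 hR2 hd)
    refine le_trans ?_ (mul_le_mul_right
      (h.measure_clipFails_le p (hpα ▸ hα) hN hT s (δ := 2 ^ j * d) (by positivity)) _)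
    rw [← lintegral_indicator_const (hfm _)]
    refine lintegral_mono fun ω => ?_
    simp [Set.indicator_apply]
  have hcint : ∀ a ∈ big, ENNReal.ofReal (gap ν a) * ∫⁻ ω, cnt a ω ∂P ≤
      ENNReal.ofReal (A * (R / N)) := fun a ha => by
    have hda : d ≤ gap ν a / 2 := by
      have := (Finset.mem_filter.1 ha).2
      linarith
    have hα0 : 0 ≤ p.α := by rw [hpα]; linarith
    have h1 := hcount N p hN hpρ hα0 hp hmax P ν X Z h s a (gap ν a / 2) (hd0.trans_le hda)
      (by rw [← hs a]; ring)
    refine (mul_le_mul_right h1 _).trans ?_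
    rw [← ENNReal.ofReal_mul (gap_nonneg ν a)]
    apply ENNReal.ofReal_le_ofReal
    have h2 := large_gap_contribution_le hC hα0 hT' hN' hR0 hR2 hd hda
    rw [mul_div_cancel₀ (gap ν a) two_ne_zero, hpα] at h2
    rw [hpα]
    exact h2
  refine (lintegral_mono hpath).trans ?_
  rw [lintegral_add_left measurable_const, lintegral_const, measure_univ, mul_one,
    lintegral_add_left (by fun_prop), lintegral_const_mul _ (by fun_prop),
    lintegral_add_left measurable_const, lintegral_const, measure_univ, mul_one,
    lintegral_finsetSum _ fun a _ => (hcm a).const_mul _]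
  simp_rw [lintegral_const_mul _ (hcm _)]
  have hsum : ∑ a ∈ big, ENNReal.ofReal (gap ν a) * ∫⁻ ω, cnt a ω ∂P ≤ ENNReal.ofReal (A * R) := by
    refine (Finset.sum_le_card_nsmul _ _ _ hcint).trans ?_
    have hcard : big.card ≤ N := (Finset.card_filter_le _ _).trans (by simp)
    rw [nsmul_eq_mul]
    calc (big.card : ℝ≥0∞) * ENNReal.ofReal (A * (R / N))
        ≤ (N : ℝ≥0∞) * ENNReal.ofReal (A * (R / N)) := by gcongr
      _ = ENNReal.ofReal (A * R) := by
        rw [← ENNReal.ofReal_natCast, ← ENNReal.ofReal_mul hN'.le]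
        congr 1
        field_simp
  calc ∑ a, ENNReal.ofReal (gap ν a) + (p.T * (ENNReal.ofReal (2 * d) + ∫⁻ ω, B ω ∂P) +
        ∑ a ∈ big, ENNReal.ofReal (gap ν a) * ∫⁻ ω, cnt a ω ∂P)
      ≤ ENNReal.ofReal (∑ a, gap ν a) + (ENNReal.ofReal p.T *
        (ENNReal.ofReal (2 * d) + ENNReal.ofReal (192 * d)) + ENNReal.ofReal (A * R)) := by
        rw [ENNReal.ofReal_sum_of_nonneg fun a _ => gap_nonneg ν a, ENNReal.ofReal_natCast]
        gcongr
    _ = ENNReal.ofReal (∑ a, gap ν a + (p.T * (2 * d + 192 * d) + A * R)) := by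
        rw [← ENNReal.ofReal_add (by positivity) (by positivity),
          ← ENNReal.ofReal_mul hT'.le, ← ENNReal.ofReal_add (by positivity) (by positivity),
          ← ENNReal.ofReal_add hG0 (by positivity)]
    _ ≤ _ := by
        apply ENNReal.ofReal_le_ofReal
        have hTd : p.T * d = R := by rw [hd]; field_simp
        have h1 : p.T * (2 * d + 192 * d) = 194 * R := by rw [← hTd]; ring
        rw [h1]
        nlinarith [mul_nonneg hA0 hG0]

end MainBound

end BMOTS

theorem mainTheorem1 (ρ α : ℝ) (hρ : 1 / 2 < ρ) (hρ' : ρ < 1) (hα : 4 ≤ α) :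
    ∃ C : ℝ, ∀ (N : ℕ) (p : BMOTS.Params N), 0 < N → p.ρ = ρ → p.α = α →
      Measurable p.argmax → (∀ (θ : Fin N → ℝ) (b : Fin N), θ b ≤ θ (p.argmax θ)) →
      ∀ {Ω : Type*} [MeasurableSpace Ω] (P : Measure Ω) [IsProbabilityMeasure P]
        (ν : Fin N → Measure ℝ) [∀ a, IsProbabilityMeasure (ν a)]
        (X : Fin N → ℕ → Ω → ℝ) (Z : ℕ → Fin N → Ω → ℝ), BMOTS.IsModel P ν X Z →
        Integrable (fun ω => BMOTS.regret p ν (fun a i => X a i ω) (fun t a => Z t a ω)) P ∧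
        ∫ ω, BMOTS.regret p ν (fun a i => X a i ω) (fun t a => Z t a ω) ∂P
            ≤ C * (√((N : ℝ) * p.T) + ∑ a, BMOTS.gap ν a) ∧
        ((∀ a, BMOTS.gap ν a ≤ 1) →
          ∫ ω, BMOTS.regret p ν (fun a i => X a i ω) (fun t a => Z t a ω) ∂P
            ≤ C * √((N : ℝ) * p.T)) ∧
        ∀ ω, (BMOTS.state p (fun a i => X a i ω) (fun t a => Z t a ω) p.T).batches
            ≤ N * (Nat.log 2 p.T + 1) := by
  obtain ⟨C, hC, hbound⟩ := BMOTS.exists_lintegral_regret_le (by linarith : 0 < ρ) hρ' hα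
  -- The factor `2` serves the case of gaps at most one: for `N ≤ T` the sum of the gaps is at most
  -- `N ≤ √(NT)`. For `T < N` the trivial bound `T ≤ √(NT)` suffices.
  refine ⟨2 * C, ?_⟩
  intro N p hN hpρ hpα hp hmax Ω _ P _ ν _ X Z h
  have hint := BMOTS.integrable_regret p hp ν h
  have hG0 : 0 ≤ ∑ a, BMOTS.gap ν a := Finset.sum_nonneg fun a _ => BMOTS.gap_nonneg ν a
  have hR0 := Real.sqrt_nonneg ((N : ℝ) * p.T)
  have hmain : ∫ ω, BMOTS.regret p ν (fun a i => X a i ω) (fun t a => Z t a ω) ∂P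
      ≤ C * (√((N : ℝ) * p.T) + ∑ a, BMOTS.gap ν a) := by
    rcases Nat.eq_zero_or_pos p.T with hT | hT
    · simp only [BMOTS.regret, hT, Finset.range_zero, Finset.sum_empty, integral_zero]
      positivity
    · rw [integral_eq_lintegral_of_nonneg_ae (ae_of_all _ fun ω => BMOTS.regret_nonneg _ _ _ _)
        hint.aestronglyMeasurable]
      exact ENNReal.toReal_le_of_le_ofReal (by positivity)
        (hbound N p hN hT hpρ hpα hp hmax P ν X Z h)
  refine ⟨hint, hmain.trans ?_, fun hgap => ?_, fun ω => BMOTS.batches_le _ _ _ _⟩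
  · gcongr
    linarith
  · rcases le_or_gt N p.T with hNT | hNT
    · have hsum : ∑ a, BMOTS.gap ν a ≤ √((N : ℝ) * p.T) := by
        calc ∑ a, BMOTS.gap ν a ≤ ∑ _a : Fin N, (1 : ℝ) := Finset.sum_le_sum fun a _ => hgap a
          _ = N := by simp
          _ = √((N : ℝ) * N) := (Real.sqrt_mul_self N.cast_nonneg).symm
          _ ≤ _ := by gcongr
      nlinarith
    · have hreg : ∫ ω, BMOTS.regret p ν (fun a i => X a i ω) (fun t a => Z t a ω) ∂P ≤ p.T := by
        refine (integral_mono hint (integrable_const (p.T : ℝ)) fun ω => ?_).trans (by simp)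
        simpa using BMOTS.regret_le p ν hgap (fun a i => X a i ω) (fun t a => Z t a ω)
      have hTR : (p.T : ℝ) ≤ √((N : ℝ) * p.T) := by
        calc (p.T : ℝ) = √((p.T : ℝ) * p.T) := (Real.sqrt_mul_self p.T.cast_nonneg).symm
          _ ≤ _ := by gcongr
      nlinarith
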